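/- Define rational numbers $B(d_1,\dots,d_n)$ for $n\ge 1$ and integers $d_1,\dots,d_n\ge 0$ by $B(0)=\tfrac18$ and, for every $d\ge0$, $n\ge 0$ and $d_1,\dots,d_n\ge0$ with $(d,n)\neq(0,0)$, the recursion $$B(d,d_1,\dots,d_n)=\sum_{i=1}^n(2d_i+1)\,B(d_1,\dots,d_i+d,\dots,d_n)+\frac12\sum_{\substack{a,b\ge0\\ a+b=d-1}}\Bigl(B(a,b,d_1,\dots,d_n)+\sum_{I\sqcup J=\{1,\dots,n\}}B\bigl(a,(d_i)_{i\in I}\bigr)\,B\bigl(b,(d_j)_{j\in J}\bigr)\Bigr),$$ where the last sum is over all ordered pairs $(I,J)$ of complementary subsets; these relations determine $B$ uniquely, by induction on $\sum_j(2d_j+1)$. For $\mathbf d=(d_1,\dots,d_n)\in(\mathbb Z_{\ge0})^n$, $n\ge1$, put $g(\mathbf d)=d_1+\cdots+d_n+1$ and $X(\mathbf d)=\sum_{j=1}^n(2d_j+1)$. The Brézin–Gross–Witten (BGW) numbers are $$\langle\tau_{d_1}\cdots\tau_{d_n}\rangle^{\Theta}_{g(\mathbf d)}=\frac{B(d_1,\dots,d_n)}{\prod_{j=1}^n(2d_j+1)!!},$$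 and the normalized BGW numbers are $$C(\mathbf d)=\frac{2^{2g(\mathbf d)-1}\prod_{j=1}^n(2d_j+1)!!}{(X(\mathbf d)-1)!}\,\langle\tau_{d_1}\cdots\tau_{d_n}\rangle^{\Theta}_{g(\mathbf d)}.$$ Theorem. One has $C(\mathbf d)=\frac1\pi+O\bigl(\frac1{g(\mathbf d)}\bigr)$ uniformly in $n$ and $\mathbf d$; that is, there is an absolute constant $K$ such that $$\Bigl|C(\mathbf d)-\frac1\pi\Bigr|\le\frac{K}{g(\mathbf d)}\qquad\text{for all } n\ge1 \text{ and all } \mathbf d\in(\mathbb Z_{\ge0})^n.$$ -/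

import Mathlib

namespace BGW

open scoped Nat

/-- `X(d₁,…,dₙ) = ∑ (2 dⱼ + 1)` for a finite sequence given as a list. -/
def weight (l : List ℕ) : ℕ := (l.map fun d => 2 * d + 1).sum

/-- The subsequence `(dᵢ)_{i ∈ I}` of `ds`, in increasing order of the indices. -/
def subseq (ds : List ℕ) (I : Finset (Fin ds.length)) : List ℕ :=
  ((List.finRange ds.length).filter fun i => i ∈ I).map ds.get

theorem weight_subseq_le (ds : List ℕ) (I : Finset (Fin ds.length)) :
    weight (subseq ds I) ≤ weight ds := by
  have h : (subseq ds I).Sublist ds := by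
    have h1 : ((List.finRange ds.length).filter fun i => i ∈ I).Sublist
        (List.finRange ds.length) := List.filter_sublist
    have h2 := h1.map ds.get
    rwa [List.map_get_finRange] at h2
  exact (h.map _).sum_le_sum (fun _ _ => Nat.zero_le _)

theorem weight_set (ds : List ℕ) (i : Fin ds.length) (d : ℕ) :
    weight (ds.set i (ds.get i + d)) = weight ds + 2 * d := by
  induction ds with
  | nil => exact i.elim0
  | cons x xs ih =>
    refine Fin.cases ?_ (fun j => ?_) i
    · simp [weight]; ring
    · have := ih j
      simp [weight] at this ⊢
      omega

/-- The numbers `B(d₁,…,dₙ) = ⟨τ_{d₁} ⋯ τ_{dₙ}⟩^Θ ∏ (2 dⱼ + 1)!!`, computed from `B(0) = 1/8` by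
the recursion
`B(d, d₁,…,dₙ) = ∑ᵢ (2 dᵢ + 1) B(d₁,…,dᵢ + d,…,dₙ)
  + ½ ∑_{a+b=d-1} (B(a, b, d₁,…,dₙ) + ∑_{I ⊔ J = {1,…,n}} B(a, d_I) B(b, d_J))`
(equivalent to the Virasoro constraints on the partition function), which is used for all
`(d, d₁,…,dₙ)` other than the one-term sequence `(0)`.
The pairs `(a, b)` are written as `(a, d - 1 - a)` with `a < d`, and `J` is the complement of `I`.
The empty sequence never occurs in the recursion; its value is a convention. -/
def B : List ℕ → ℚ
  | [] => 0
  | d :: ds =>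
    if d = 0 ∧ ds = [] then 1 / 8
    else
      (∑ i : Fin ds.length, (2 * (ds.get i : ℚ) + 1) * B (ds.set i (ds.get i + d)))
      + 1 / 2 * ∑ a : Fin d,
          (B ((a : ℕ) :: (d - 1 - (a : ℕ)) :: ds)
            + ∑ I : Finset (Fin ds.length),
                B ((a : ℕ) :: subseq ds I) * B ((d - 1 - (a : ℕ)) :: subseq ds Iᶜ))
termination_by l => weight l
decreasing_by
  · rw [weight_set]; simp [weight]; omega
  · have := a.isLt
    simp [weight]; omega
  · have := a.isLt
    have := weight_subseq_le ds I
    simp [weight] at this ⊢; omega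
  · have := a.isLt
    have := weight_subseq_le ds Iᶜ
    simp [weight] at this ⊢; omega

variable {n : ℕ}

/-- The genus `g(d) = d₁ + ⋯ + dₙ + 1`. -/
def genus (d : Fin n → ℕ) : ℕ := ∑ j, d j + 1

/-- `X(d) = ∑ⱼ (2 dⱼ + 1)`. -/
def X (d : Fin n → ℕ) : ℕ := ∑ j, (2 * d j + 1)

/-- The Brézin–Gross–Witten number `⟨τ_{d₁} ⋯ τ_{dₙ}⟩^Θ_{g(d)}` (for `n ≥ 1`). -/
def bgwNumber (d : Fin n → ℕ) : ℚ :=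
  B (List.ofFn d) / ∏ j, (((2 * d j + 1)‼ : ℕ) : ℚ)

/-- The normalized BGW number `C(d)` (for `n ≥ 1`, so that `X(d) ≥ 1`). -/
def C (d : Fin n → ℕ) : ℚ :=
  2 ^ (2 * genus d - 1) * (∏ j, (((2 * d j + 1)‼ : ℕ) : ℚ)) / (((X d - 1)! : ℕ) : ℚ) * bgwNumber d

end BGW

/-! Why the theorem is true. Write m for the sum of the entries and n for their number. After
normalization the recursion says that (X - 1) C(d, d_1, ...) is a sum of values of C with
nonnegative coefficients adding up to X - 1, plus a nonnegative quadratic term (`nc_cons`). So C is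
a weighted average of values at smaller X, up to an error that is small because the quadratic term
carries inverse binomial coefficients. Merging an entry into another keeps m and lowers n; splitting
d lowers m by one and raises n. Two inputs make this an estimate.

Symmetry. B is invariant under permutations (`B_perm`), so the recursion may be applied to the
smallest entry d, for which d n ≤ m. Then splitting has total weight 2d/(X - 1) ≤ 1/n and merging
dominates. The recursion is not visibly symmetric. Exponentiating B in the shuffle algebra gives a
partition function `Z` with a linear recursion (`Z_cons`), whose symmetry follows from the Virasoro
commutation relations (`Z_swap`, `Z_perm`); symmetry passes back to B on dividing by `Z`.

One-point values. Merging eventually leads to n = 1, where the limit is read off. Regard `Z` as a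
functional on polynomials in odd power sums p_k. Its values on products h_i h_j of complete
functions have differences bilinear in Bessel coefficients (`pair_succ_sub`), and p_k is an
alternating sum of such products. Hence B(k) is, up to a factor, a coefficient of y(x) y(-x) for the
Bessel series y (`B_singleton`). A two-term recursion follows, and the normalized one-point numbers
are reciprocals of Wallis products up to an explicit factor, tending to 1/π
(`abs_nc_singleton_sub`).

Conclusion. The crude bound C ≤ g/4 (`nc_le_linear`) controls the quadratic term. The function `psi`
is a supersolution of the averaging inequality (`psi_step`), so induction on X gives |C - 1/π| ≤
1000 psi(m, n), with n now counting only positive entries (zeros do not affect C). Since n ≤ m, this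
is O(1/m). -/

namespace BGW

/-! ### The shuffle algebra of functions on lists -/

/-- Rational-valued functions on lists of natural numbers, with the shuffle product. -/
def Sh : Type := List ℕ → ℚ

/-- The sum `∑ f(l_I) g(l_J)` over all ways to split `l` into complementary subsequences. -/
def shuffle : List ℕ → (List ℕ → ℚ) → (List ℕ → ℚ) → ℚ
  | [], f, g => f [] * g []
  | s :: l, f, g => shuffle l (fun t => f (s :: t)) g + shuffle l f (fun t => g (s :: t))

namespace Sh

instance : AddCommGroup Sh := inferInstanceAs (AddCommGroup (List ℕ → ℚ))

instance : Mul Sh := ⟨fun f g l => shuffle l f g⟩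

instance : One Sh := ⟨fun l => if l = [] then 1 else 0⟩

/-- Prepending `s` to the argument. -/
def der (s : ℕ) (f : Sh) : Sh := fun l => f (s :: l)

theorem add_apply (f g : Sh) (l : List ℕ) : (f + g) l = f l + g l := rfl

theorem sub_apply (f g : Sh) (l : List ℕ) : (f - g) l = f l - g l := rfl

theorem zero_apply (l : List ℕ) : (0 : Sh) l = 0 := rfl

theorem mul_nil (f g : Sh) : (f * g) [] = f [] * g [] := rfl

theorem der_add (s : ℕ) (f g : Sh) : der s (f + g) = der s f + der s g := rfl

theorem der_neg (s : ℕ) (f : Sh) : der s (-f) = -der s f := rfl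

theorem der_sub (s : ℕ) (f g : Sh) : der s (f - g) = der s f - der s g := rfl

theorem der_zero (s : ℕ) : der s 0 = 0 := rfl

/-- The Leibniz rule is the recursive clause of the shuffle product. A function is determined by its
value at `[]` and its derivatives, so ring identities reduce to induction on the list. -/
theorem der_mul (s : ℕ) (f g : Sh) : der s (f * g) = der s f * g + f * der s g := rfl

theorem der_one (s : ℕ) : der s 1 = 0 := rfl

theorem ext_iff_der {f g : Sh} : f = g ↔ f [] = g [] ∧ ∀ s, der s f = der s g := by
  refine ⟨fun h => h ▸ ⟨rfl, fun _ => rfl⟩, fun ⟨h0, h⟩ => funext fun l => ?_⟩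
  cases l with
  | nil => exact h0
  | cons s l => exact congrFun (h s) l

theorem apply_cons (f : Sh) (s : ℕ) (l : List ℕ) : f (s :: l) = der s f l := rfl

theorem mul_comm' (f g : Sh) : f * g = g * f := by
  funext l
  induction l generalizing f g with
  | nil => exact mul_comm _ _
  | cons s l ih =>
    simp only [apply_cons, der_mul, add_apply]
    rw [ih (der s f) g, ih f (der s g), add_comm]

theorem add_mul' (f g k : Sh) : (f + g) * k = f * k + g * k := by
  funext l
  induction l generalizing f g k with
  | nil => exact add_mul _ _ _
  | cons s l ih =>
    have h1 := ih (der s f) (der s g) k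
    have h2 := ih f g (der s k)
    simp only [apply_cons, der_mul, add_apply, der_add] at *
    rw [h1, h2]; ring

theorem zero_mul' (f : Sh) : 0 * f = 0 := by
  have h := add_mul' 0 0 f
  simpa using h

theorem one_mul' (f : Sh) : 1 * f = f := by
  funext l
  induction l generalizing f with
  | nil => exact one_mul _
  | cons s l ih =>
    simp only [apply_cons, der_mul, der_one, zero_mul', zero_add, ih]

theorem mul_assoc' (f g k : Sh) : f * g * k = f * (g * k) := by
  funext l
  induction l generalizing f g k with
  | nil => exact mul_assoc _ _ _
  | cons s l ih =>
    have e1 : der s (f * g * k) = der s f * g * k + f * der s g * k + f * g * der s k := by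
      rw [der_mul, der_mul, add_mul']
    have e2 : der s (f * (g * k)) =
        der s f * (g * k) + (f * (der s g * k) + f * (g * der s k)) := by
      rw [der_mul, der_mul, mul_comm' f (_ + _), add_mul', mul_comm' _ f, mul_comm' _ f]
    change der s (f * g * k) l = der s (f * (g * k)) l
    rw [e1, e2]
    simp only [add_apply, ih]
    ring

instance : CommRing Sh :=
  { (inferInstance : AddCommGroup Sh) with
    mul := (· * ·)
    one := 1
    mul_comm := mul_comm'
    mul_assoc := mul_assoc'
    one_mul := one_mul'
    mul_one := fun f => by rw [mul_comm', one_mul']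
    zero_mul := zero_mul'
    mul_zero := fun f => by rw [mul_comm', zero_mul']
    right_distrib := add_mul'
    left_distrib := fun f g k => by
      rw [mul_comm' f, add_mul', mul_comm' g, mul_comm' k] }

theorem sum_apply {ι : Type*} (s : Finset ι) (f : ι → Sh) (l : List ℕ) :
    (∑ i ∈ s, f i) l = ∑ i ∈ s, f i l := Finset.sum_apply (M := fun _ : List ℕ => ℚ) l s f

/-- The constant `c` times the unit. -/
def const (c : ℚ) : Sh := fun l => if l = [] then c else 0

theorem der_const (s : ℕ) (c : ℚ) : der s (const c) = 0 := rfl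

theorem const_mul_apply (c : ℚ) (f : Sh) (l : List ℕ) : (const c * f) l = c * f l := by
  induction l generalizing f with
  | nil => rfl
  | cons s l ih =>
    simp only [apply_cons, der_mul, der_const, zero_mul, zero_add]
    exact ih _

end Sh

/-! ### The raising operators, half of the Virasoro action -/

open Sh

/-- `∑ᵢ (2 sᵢ + 1) f(s₁, …, sᵢ + d, …, sₙ)`. -/
def raiseSum (d : ℕ) : List ℕ → (List ℕ → ℚ) → ℚ
  | [], _ => 0
  | s :: l, f => (2 * s + 1) * f ((s + d) :: l) + raiseSum d l (fun t => f (s :: t))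

/-- The operator `raiseSum` on the shuffle algebra. -/
def Sh.raise (d : ℕ) (f : Sh) : Sh := fun l => raiseSum d l f

namespace Sh

theorem raise_nil (d : ℕ) (f : Sh) : raise d f [] = 0 := rfl

theorem raise_cons (d s : ℕ) (f : Sh) (l : List ℕ) :
    raise d f (s :: l) = (2 * s + 1) * f ((s + d) :: l) + raise d (der s f) l := rfl

theorem der_raise (d s : ℕ) (f : Sh) :
    der s (raise d f) = const (2 * s + 1) * der (s + d) f + raise d (der s f) := by
  funext l
  rw [add_apply, const_mul_apply]
  rfl

theorem raise_add (d : ℕ) (f g : Sh) : raise d (f + g) = raise d f + raise d g := by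
  funext l
  induction l generalizing f g with
  | nil => simp [raise_nil, add_apply]
  | cons s l ih =>
    have := ih (der s f) (der s g)
    simp only [raise_cons, add_apply, der_add] at *
    rw [this]; ring

theorem raise_zero (d : ℕ) : raise d 0 = 0 := by
  simpa using raise_add d 0 0

theorem raise_sum {ι : Type*} (s : Finset ι) (d : ℕ) (f : ι → Sh) :
    raise d (∑ i ∈ s, f i) = ∑ i ∈ s, raise d (f i) := by
  classical
  induction s using Finset.induction_on with
  | empty => simp [raise_zero]
  | insert a s ha ih => rw [Finset.sum_insert ha, Finset.sum_insert ha, raise_add, ih]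

theorem raise_const_mul (d : ℕ) (c : ℚ) (f : Sh) : raise d (const c * f) = const c * raise d f := by
  funext l
  induction l generalizing f with
  | nil => simp [raise_nil, const_mul_apply]
  | cons s l ih =>
    have := ih (der s f)
    rw [const_mul_apply] at this ⊢
    rw [raise_cons, raise_cons, const_mul_apply, der_mul, der_const, zero_mul, zero_add, this]
    ring

/-- The operator changes one entry at a time, and that entry belongs to exactly one of the two parts
of a splitting; hence it is a derivation. -/
theorem raise_mul (d : ℕ) (f g : Sh) : raise d (f * g) = raise d f * g + f * raise d g := by
  funext l
  induction l generalizing f g with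
  | nil => simp [raise_nil, add_apply, mul_nil]
  | cons s l ih =>
    have h1 := ih (der s f) g
    have h2 := ih f (der s g)
    have e : der s (raise d (f * g)) l = (der s (raise d f * g + f * raise d g)) l := by
      rw [der_raise, der_mul, der_mul, raise_add, der_add, der_mul, der_mul, der_raise, der_raise]
      have : (const (2 * ↑s + 1) * (der (s + d) f * g + f * der (s + d) g)
          + (raise d (der s f) * g + der s f * raise d g
            + (raise d f * der s g + f * raise d (der s g)))) l =
        ((const (2 * ↑s + 1) * der (s + d) f + raise d (der s f)) * g + raise d f * der s g +
          (der s f * raise d g + f * (const (2 * ↑s + 1) * der (s + d) g + raise d (der s g)))) l := by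
        refine congrFun (?_ : (_ : Sh) = _) l
        ring
      rw [← this]
      simp only [add_apply] at *
      rw [h1, h2]
    exact e

/-- The commutation relation `[E_d, E_e] = 2 (d - e) E_{d+e}`. -/
theorem raise_raise_sub (d e : ℕ) (f : Sh) (l : List ℕ) :
    raise d (raise e f) l - raise e (raise d f) l = 2 * ((d : ℚ) - e) * raise (d + e) f l := by
  induction l generalizing f with
  | nil => simp [raise_nil]
  | cons s l ih =>
    have h := ih (der s f)
    simp only [raise_cons, der_raise, raise_add, raise_const_mul, add_apply, const_mul_apply]
    have e1 : s + e + d = s + (d + e) := by ring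
    have e2 : s + d + e = s + (d + e) := by ring
    rw [e1, e2]
    push_cast
    linear_combination h

end Sh

theorem raiseSum_eq_sum (d : ℕ) (l : List ℕ) (f : List ℕ → ℚ) :
    raiseSum d l f =
      ∑ i : Fin l.length, (2 * (l.get i : ℚ) + 1) * f (l.set i (l.get i + d)) := by
  induction l generalizing f with
  | nil => simp [raiseSum]
  | cons s l ih =>
    rw [raiseSum, ih]
    simp only [List.length_cons]
    rw [Fin.sum_univ_succ]
    rfl

end BGW

/-! ### The recursion in the shuffle algebra and the partition function -/

namespace BGW
open scoped Nat

theorem sum_finset_fin_succ {M : Type*} [AddCommMonoid M] (n : ℕ) (F : Finset (Fin (n + 1)) → M) :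
    ∑ I, F I = ∑ I : Finset (Fin n), F (insert 0 (I.map (Fin.succEmb n)))
      + ∑ I : Finset (Fin n), F (I.map (Fin.succEmb n)) := by
  classical
  have h0 : (0 : Fin (n + 1)) ∉ (Finset.univ : Finset (Fin n)).map (Fin.succEmb n) := by simp
  have hu : (Finset.univ : Finset (Finset (Fin (n + 1)))) =
      (insert 0 ((Finset.univ : Finset (Fin n)).map (Fin.succEmb n))).powerset := by
    rw [← Finset.powerset_univ]
    congr 1
    ext i
    refine Fin.cases ?_ (fun j => ?_) i <;> simp
  have key : ∀ G : Finset (Fin (n + 1)) → M,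
      ∑ I ∈ ((Finset.univ : Finset (Fin n)).map (Fin.succEmb n)).powerset, G I =
        ∑ I : Finset (Fin n), G (I.map (Fin.succEmb n)) := by
    intro G
    symm
    refine Finset.sum_bij (fun I _ => I.map (Fin.succEmb n)) ?_ ?_ ?_ ?_
    · intro I _
      exact Finset.mem_powerset.2 (Finset.map_subset_map.2 (Finset.subset_univ I))
    · intro I _ J _ h
      exact Finset.map_injective _ h
    · intro J hJ
      obtain ⟨I, -, rfl⟩ := Finset.subset_map_iff.1 (Finset.mem_powerset.1 hJ)
      exact ⟨I, Finset.mem_univ _, rfl⟩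
    · intro I _; rfl
  rw [hu, Finset.sum_powerset_insert h0, key, key (fun I => F (insert 0 I)), add_comm]

theorem subseq_insert_zero (s : ℕ) (l : List ℕ) (I : Finset (Fin l.length)) :
    subseq (s :: l) (insert 0 (I.map (Fin.succEmb l.length))) = s :: subseq l I := by
  simp only [subseq, List.length_cons, List.finRange_succ]
  rw [List.filter_cons_of_pos (by simp), List.map_cons, List.filter_map, List.map_map]
  congr 2
  refine congrArg (fun p => List.filter p (List.finRange l.length)) (funext fun i => ?_)
  simp [Fin.succ_ne_zero]

theorem subseq_map_succ (s : ℕ) (l : List ℕ) (I : Finset (Fin l.length)) :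
    subseq (s :: l) (I.map (Fin.succEmb l.length)) = subseq l I := by
  simp only [subseq, List.length_cons, List.finRange_succ]
  rw [List.filter_cons_of_neg (by simp), List.filter_map, List.map_map]
  congr 1
  refine congrArg (fun p => List.filter p (List.finRange l.length)) (funext fun i => ?_)
  simp

theorem compl_map_succ {n : ℕ} (I : Finset (Fin n)) :
    (I.map (Fin.succEmb n))ᶜ = insert 0 (Iᶜ.map (Fin.succEmb n)) := by
  ext i
  refine Fin.cases ?_ (fun j => ?_) i <;> simp

theorem compl_insert_zero {n : ℕ} (I : Finset (Fin n)) :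
    (insert 0 (I.map (Fin.succEmb n)))ᶜ = Iᶜ.map (Fin.succEmb n) := by
  ext i
  refine Fin.cases ?_ (fun j => ?_) i <;> simp

theorem shuffle_eq_sum (l : List ℕ) (f g : List ℕ → ℚ) :
    shuffle l f g = ∑ I : Finset (Fin l.length), f (subseq l I) * g (subseq l Iᶜ) := by
  induction l generalizing f g with
  | nil => simp [shuffle, subseq]
  | cons s l ih =>
    have h := sum_finset_fin_succ l.length
      (fun I : Finset (Fin (s :: l).length) => f (subseq (s :: l) I) * g (subseq (s :: l) Iᶜ))
    rw [shuffle, ih, ih]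
    refine Eq.trans ?_ h.symm
    congr 1
    · refine Finset.sum_congr rfl fun I _ => ?_
      rw [subseq_insert_zero, show (insert 0 (I.map (Fin.succEmb l.length)))ᶜ = _ from
        compl_insert_zero I, subseq_map_succ]
    · refine Finset.sum_congr rfl fun I _ => ?_
      rw [subseq_map_succ, show (I.map (Fin.succEmb l.length))ᶜ = _ from
        compl_map_succ I, subseq_insert_zero]

/-- For the sequence (0) all sums are empty, so the initial value enters as an additive term and the
recursion holds without exception. -/
theorem B_cons (d : ℕ) (l : List ℕ) :
    B (d :: l) = raiseSum d l B
      + 1 / 2 * ∑ a ∈ Finset.range d, (B (a :: (d - 1 - a) :: l)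
        + shuffle l (fun t => B (a :: t)) (fun t => B ((d - 1 - a) :: t)))
      + if d = 0 ∧ l = [] then 1 / 8 else 0 := by
  rw [B]
  split_ifs with h
  · obtain ⟨rfl, rfl⟩ := h
    simp [raiseSum]
  · rw [raiseSum_eq_sum, add_zero, Finset.sum_range]
    simp only [shuffle_eq_sum]

open Sh

/-- Truncated shuffle exponential of `f`. -/
def expAux (f : Sh) : ℕ → List ℕ → ℚ
  | 0, l => if l = [] then 1 else 0
  | _ + 1, [] => 1
  | n + 1, s :: l => shuffle l (der s f) (expAux f n)

theorem shuffle_congr (l : List ℕ) (f g g' : List ℕ → ℚ)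
    (h : ∀ t : List ℕ, t.length ≤ l.length → g t = g' t) : shuffle l f g = shuffle l f g' := by
  induction l generalizing f g g' with
  | nil => simp [shuffle, h [] le_rfl]
  | cons s l ih =>
    rw [shuffle, shuffle, ih _ g g' (fun t ht => h t (ht.trans (by simp))),
      ih f (fun t => g (s :: t)) (fun t => g' (s :: t)) (fun t ht => h _ (by simpa using ht))]

/-- The depth is irrelevant once it reaches the length, since a shuffle at l evaluates its factors
only on lists no longer than l. -/
theorem expAux_eq (f : Sh) (n m : ℕ) (l : List ℕ) (hn : l.length ≤ n) (hm : l.length ≤ m) :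
    expAux f n l = expAux f m l := by
  induction n generalizing m l with
  | zero =>
    obtain rfl : l = [] := List.eq_nil_of_length_eq_zero (by omega)
    cases m <;> simp [expAux]
  | succ n ih =>
    cases l with
    | nil => cases m <;> simp [expAux]
    | cons s l =>
      cases m with
      | zero => simp at hm
      | succ m =>
        simp only [List.length_cons, add_le_add_iff_right] at hn hm
        rw [expAux, expAux]
        exact shuffle_congr _ _ _ _ fun t ht => ih m t (ht.trans hn) (ht.trans hm)

/-- The shuffle exponential of `f` (for `f [] = 0`). -/
def Sh.exp (f : Sh) : Sh := fun l => expAux f l.length l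

namespace Sh

theorem exp_nil (f : Sh) : exp f [] = 1 := by simp [exp, expAux]

theorem der_exp (f : Sh) (s : ℕ) : der s (exp f) = der s f * exp f := by
  funext l
  change expAux f (l.length + 1) (s :: l) = shuffle l (der s f) (exp f)
  rw [expAux]
  exact shuffle_congr _ _ _ _ fun t ht => expAux_eq f _ _ t ht le_rfl

theorem exp_mul_exp_neg (f : Sh) : exp f * exp (-f) = 1 := by
  refine ext_iff_der.2 ⟨?_, fun s => ?_⟩
  · rw [mul_nil, exp_nil, exp_nil, mul_one]; rfl
  · rw [der_mul, der_exp, der_exp, der_neg, der_one]; ring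

/-- The defect D of this chain rule vanishes at `[]` and satisfies der s D = der s f * D, hence is
zero. Because a product appears on the right, the induction is run for k * D with k arbitrary. -/
theorem raise_exp (d : ℕ) (f : Sh) : raise d (exp f) = raise d f * exp f := by
  have h : ∀ (l : List ℕ) (k : Sh), (k * (raise d (exp f) - raise d f * exp f)) l = 0 := by
    intro l
    induction l with
    | nil => intro k; simp [mul_nil, sub_apply, raise_nil]
    | cons s l ih =>
      intro k
      have e : der s (k * (raise d (exp f) - raise d f * exp f)) =
          der s k * (raise d (exp f) - raise d f * exp f)
          + (k * der s f) * (raise d (exp f) - raise d f * exp f) := by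
        rw [der_mul, der_sub, der_mul, der_raise, der_raise, der_exp, der_exp, raise_mul]
        ring
      change der s (k * (raise d (exp f) - raise d f * exp f)) l = 0
      rw [e, add_apply, ih, ih, add_zero]
  funext l
  have := h l 1
  rw [one_mul, sub_apply] at this
  exact sub_eq_zero.1 this

end Sh

/-- The numbers `B` as an element of the shuffle algebra. -/
def freeEnergy : Sh := B

/-- The partition function: the shuffle exponential of `B`. -/
def Z : Sh := Sh.exp freeEnergy

/-- The inhomogeneous term of the Virasoro constraints. -/
def anomaly (d : ℕ) : ℚ := if d = 0 then 1 / 8 else 0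

theorem two_mul_der_freeEnergy (d : ℕ) :
    const 2 * der d freeEnergy = const 2 * raise d freeEnergy
      + ∑ a ∈ Finset.range d, (der (d - 1 - a) (der a freeEnergy)
          + der a freeEnergy * der (d - 1 - a) freeEnergy) + const 2 * const (anomaly d) := by
  funext l
  simp only [add_apply, const_mul_apply, sum_apply]
  have h := B_cons d l
  have e : const (anomaly d) l = if d = 0 ∧ l = [] then 1 / 8 else 0 := by
    unfold const anomaly
    by_cases h1 : d = 0 <;> by_cases h2 : l = [] <;> simp [h1, h2]
  rw [e]
  change 2 * B (d :: l) = 2 * raiseSum d l B + ∑ a ∈ Finset.range d, (B (a :: (d - 1 - a) :: l)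
        + shuffle l (fun t => B (a :: t)) (fun t => B ((d - 1 - a) :: t))) + _
  rw [h]
  ring

/-- The second derivative of exp F is (F'' + F' F') exp F, so the quadratic term of the recursion
for B is absorbed and a linear recursion remains. -/
theorem Z_cons (d : ℕ) (l : List ℕ) :
    Z (d :: l) = raiseSum d l Z + 1 / 2 * ∑ a ∈ Finset.range d, Z (a :: (d - 1 - a) :: l)
      + anomaly d * Z l := by
  have h2 : ∀ a b : ℕ, der b (der a Z) = (der b (der a freeEnergy)
      + der a freeEnergy * der b freeEnergy) * Z := by
    intro a b
    rw [Z, der_exp, der_mul, der_exp]; ring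
  have h : const 2 * der d Z = const 2 * raise d Z
      + ∑ a ∈ Finset.range d, der (d - 1 - a) (der a Z) + const 2 * (const (anomaly d) * Z) := by
    simp only [h2, ← Finset.sum_mul]
    have hr : raise d Z = raise d freeEnergy * Z := raise_exp d _
    have hd : der d Z = der d freeEnergy * Z := der_exp _ d
    rw [hr, hd]
    linear_combination Z * two_mul_der_freeEnergy d
  have h3 := congrFun h l
  simp only [add_apply, const_mul_apply, sum_apply] at h3
  change 2 * Z (d :: l) = 2 * raiseSum d l Z
    + ∑ a ∈ Finset.range d, Z (a :: (d - 1 - a) :: l) + 2 * (anomaly d * Z l) at h3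
  linear_combination h3 / 2

end BGW

/-! ### Permutation invariance from the Virasoro relations -/

namespace BGW
open Sh

theorem weight_cons (s : ℕ) (l : List ℕ) : weight (s :: l) = 2 * s + 1 + weight l := by
  simp [weight]

theorem weight_perm {l l' : List ℕ} (h : l.Perm l') : weight l = weight l' :=
  (h.map _).sum_eq

theorem raiseSum_congr (d : ℕ) (l : List ℕ) (f g : List ℕ → ℚ)
    (h : ∀ t, weight t = weight l + 2 * d → f t = g t) : raiseSum d l f = raiseSum d l g := by
  induction l generalizing f g with
  | nil => rfl
  | cons s l ih =>
    rw [raiseSum, raiseSum, h _ (by simp only [weight_cons]; ring),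
      ih (fun t => f (s :: t)) (fun t => g (s :: t))
        (fun t ht => h _ (by rw [weight_cons, weight_cons, ht]; ring))]

theorem raiseSum_perm {l l' : List ℕ} (hl : l.Perm l') (d : ℕ) (f : List ℕ → ℚ)
    (hf : ∀ t t' : List ℕ, t.Perm t' → weight t = weight l + 2 * d → f t = f t') :
    raiseSum d l f = raiseSum d l' f := by
  induction hl generalizing f with
  | nil => rfl
  | cons s h ih =>
    rw [raiseSum, raiseSum, hf _ _ (h.cons _) (by simp only [weight_cons]; ring),
      ih _ fun t t' ht hw => hf _ _ (ht.cons s) (by rw [weight_cons, weight_cons, hw]; ring)]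
  | swap x y l =>
    simp only [raiseSum]
    rw [hf ((y + d) :: x :: l) _ (List.Perm.swap _ _ _) (by simp only [weight_cons]; ring),
      hf (y :: (x + d) :: l) _ (List.Perm.swap _ _ _) (by simp only [weight_cons]; ring),
      raiseSum_congr d l (fun t => f (y :: x :: t)) (fun t => f (x :: y :: t))
        fun t ht => hf _ _ (List.Perm.swap _ _ _) (by simp only [weight_cons, ht]; ring)]
    ring
  | trans h₁ h₂ ih₁ ih₂ =>
    rw [ih₁ f hf, ih₂ f fun t t' ht hw => hf t t' ht (by rw [hw, weight_perm h₁])]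

/-- The rearrangement behind the compatibility of the Virasoro constraints. -/
theorem sum_reflect_identity (G : ℕ → ℚ) (d e : ℕ)
    (hG : ∀ a < d + e, G (d + e - 1 - a) = G a) :
    ((e : ℚ) - d) * ∑ a ∈ Finset.range (d + e), G a
      + 1 / 2 * ∑ a ∈ Finset.range d,
          ((2 * a + 1) * G (a + e) + (2 * ((d - 1 - a : ℕ) : ℚ) + 1) * G a)
      - 1 / 2 * ∑ a ∈ Finset.range e,
          ((2 * a + 1) * G (a + d) + (2 * ((e - 1 - a : ℕ) : ℚ) + 1) * G a) = 0 := by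
  have h1 : ∀ d e : ℕ, (∀ a < d + e, G (d + e - 1 - a) = G a) →
      ∑ a ∈ Finset.range d, (2 * (a : ℚ) + 1) * G (a + e) =
      ∑ a ∈ Finset.range d, (2 * ((d - 1 - a : ℕ) : ℚ) + 1) * G a := by
    intro d e hG
    rw [← Finset.sum_range_reflect]
    refine Finset.sum_congr rfl fun a ha => ?_
    have ha := Finset.mem_range.1 ha
    rw [show d - 1 - a + e = d + e - 1 - a by omega, hG a (by omega)]
  -- The coefficient changes sign under a ↦ d + e - 1 - a while G is invariant.
  have h2 : ∑ a ∈ Finset.range (d + e), ((d : ℚ) + e - 1 - 2 * a) * G a = 0 := by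
    have h3 : ∑ a ∈ Finset.range (d + e), ((d : ℚ) + e - 1 - 2 * a) * G a =
        -∑ a ∈ Finset.range (d + e), ((d : ℚ) + e - 1 - 2 * a) * G a := by
      conv_lhs => rw [← Finset.sum_range_reflect]
      rw [← Finset.sum_neg_distrib]
      refine Finset.sum_congr rfl fun a ha => ?_
      have ha := Finset.mem_range.1 ha
      rw [hG a ha, Nat.sub_sub, Nat.cast_sub (by omega)]
      push_cast
      ring
    linarith
  have h4 := h1 d e hG
  have h5 := h1 e d (fun a ha => by rw [add_comm e d]; exact hG a (by omega))
  have h6 : ∑ a ∈ Finset.range d, (2 * ((d - 1 - a : ℕ) : ℚ) + 1) * G a =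
      ∑ a ∈ Finset.range d, (2 * (d : ℚ) - 2 * a - 1) * G a := by
    refine Finset.sum_congr rfl fun a ha => ?_
    have ha := Finset.mem_range.1 ha
    rw [Nat.sub_sub, Nat.cast_sub (by omega)]
    push_cast; ring
  have h7 : ∑ a ∈ Finset.range (d + e), (2 * (d : ℚ) - 2 * a - 1) * G a =
      ∑ a ∈ Finset.range d, (2 * (d : ℚ) - 2 * a - 1) * G a
      - ∑ a ∈ Finset.range e, (2 * (a : ℚ) + 1) * G (a + d) := by
    rw [Finset.sum_range_add, sub_eq_add_neg, ← Finset.sum_neg_distrib]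
    congr 1
    refine Finset.sum_congr rfl fun a _ => ?_
    rw [add_comm d a]
    push_cast; ring
  have h8 : ∑ a ∈ Finset.range (d + e), ((d : ℚ) + e - 1 - 2 * a) * G a =
      ((e : ℚ) - d) * ∑ a ∈ Finset.range (d + e), G a +
      ∑ a ∈ Finset.range (d + e), (2 * (d : ℚ) - 2 * a - 1) * G a := by
    rw [Finset.mul_sum, ← Finset.sum_add_distrib]
    refine Finset.sum_congr rfl fun a _ => by ring
  rw [Finset.sum_add_distrib, Finset.sum_add_distrib, h4, ← h5, h6]
  rw [h7, h2] at h8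
  linear_combination -h8

theorem der_Z (e : ℕ) : der e Z = Sh.raise e Z
    + const (1 / 2) * ∑ a ∈ Finset.range e, der (e - 1 - a) (der a Z) + const (anomaly e) * Z := by
  funext l
  simp only [add_apply, const_mul_apply, sum_apply]
  exact Z_cons e l

/-- Both sides are expanded by the recursion in the first entry and then in the second. Everything
matches up to exchanging d and e except multiples of e - d: the commutator of the raising operators
against the merged term Z(d + e, l). Expanding the latter once more cancels the raising part and
leaves the reflection identity. -/
theorem Z_swap (W : ℕ) (ih : ∀ l l' : List ℕ, l.Perm l' → weight l < W → Z l = Z l')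
    (d e : ℕ) (l : List ℕ) (hW : weight (d :: e :: l) = W) : Z (d :: e :: l) = Z (e :: d :: l) := by
  simp only [weight_cons] at hW
  have expand : ∀ d e : ℕ, weight (d :: e :: l) = W → Z (d :: e :: l) =
      (2 * e + 1) * Z ((e + d) :: l) + Sh.raise d (Sh.raise e Z) l
      + 1 / 2 * ∑ a ∈ Finset.range e, Sh.raise d (der (e - 1 - a) (der a Z)) l
      + anomaly e * Sh.raise d Z l
      + 1 / 2 * ∑ a ∈ Finset.range d, ((2 * a + 1) * Z ((a + e) :: (d - 1 - a) :: l)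
          + (2 * ((d - 1 - a : ℕ) : ℚ) + 1) * Z (a :: (d - 1 - a + e) :: l))
      + 1 / 2 * ∑ a ∈ Finset.range d, Sh.raise e (der (d - 1 - a) (der a Z)) l
      + 1 / 4 * ∑ a ∈ Finset.range d, ∑ a' ∈ Finset.range e,
          Z (a' :: (e - 1 - a') :: a :: (d - 1 - a) :: l)
      + 1 / 2 * anomaly e * ∑ a ∈ Finset.range d, Z (a :: (d - 1 - a) :: l)
      + anomaly d * Sh.raise e Z l
      + 1 / 2 * anomaly d * ∑ a ∈ Finset.range e, Z (a :: (e - 1 - a) :: l)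
      + anomaly d * anomaly e * Z l := by
    intro d e hw
    simp only [weight_cons] at hw
    have h1 : raiseSum d (e :: l) Z = (2 * e + 1) * Z ((e + d) :: l) + Sh.raise d (der e Z) l := rfl
    have h2 : Sh.raise d (der e Z) l = Sh.raise d (Sh.raise e Z) l
      + 1 / 2 * ∑ a ∈ Finset.range e, Sh.raise d (der (e - 1 - a) (der a Z)) l
      + anomaly e * Sh.raise d Z l := by
      rw [der_Z, raise_add, raise_add, raise_const_mul, raise_const_mul, raise_sum]
      simp only [add_apply, const_mul_apply, sum_apply]
    have h3 : ∀ a ∈ Finset.range d, Z (a :: (d - 1 - a) :: e :: l) =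
        ((2 * a + 1) * Z ((a + e) :: (d - 1 - a) :: l)
          + (2 * ((d - 1 - a : ℕ) : ℚ) + 1) * Z (a :: (d - 1 - a + e) :: l))
        + Sh.raise e (der (d - 1 - a) (der a Z)) l
        + 1 / 2 * ∑ a' ∈ Finset.range e, Z (a' :: (e - 1 - a') :: a :: (d - 1 - a) :: l)
        + anomaly e * Z (a :: (d - 1 - a) :: l) := by
      intro a ha
      have ha := Finset.mem_range.1 ha
      -- Splitting d has lowered the weight to W - 1, so the inductive hypothesis may move e to the
      -- front.
      have hp : (a :: (d - 1 - a) :: e :: l).Perm (e :: a :: (d - 1 - a) :: l) :=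
        ((List.Perm.swap e (d - 1 - a) l).cons a).trans (List.Perm.swap e a _)
      rw [ih _ _ hp (by simp only [weight_cons]; omega), Z_cons]
      have : raiseSum e (a :: (d - 1 - a) :: l) Z = (2 * a + 1) * Z ((a + e) :: (d - 1 - a) :: l)
          + ((2 * ((d - 1 - a : ℕ) : ℚ) + 1) * Z (a :: (d - 1 - a + e) :: l)
          + Sh.raise e (der (d - 1 - a) (der a Z)) l) := rfl
      rw [this]; ring
    rw [Z_cons, h1, h2, Finset.sum_congr rfl h3, Z_cons e l]
    simp only [Finset.sum_add_distrib, ← Finset.mul_sum]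
    change _ = _ + anomaly d * raiseSum e l Z + _ + _
    ring
  have hc := raise_raise_sub d e Z l
  have hde : Z ((d + e) :: l) = Sh.raise (d + e) Z l
      + 1 / 2 * ∑ a ∈ Finset.range (d + e), Z (a :: (d + e - 1 - a) :: l)
      + anomaly (d + e) * Z l := Z_cons (d + e) l
  -- The anomaly lives in degree zero only, where d = e = 0 and the prefactor vanishes.
  have hA : ((e : ℚ) - d) * anomaly (d + e) = 0 := by
    unfold anomaly
    split_ifs with h
    · obtain ⟨rfl, rfl⟩ : d = 0 ∧ e = 0 := by omega
      simp
    · simp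
  have hquad : ∑ a ∈ Finset.range d, ∑ a' ∈ Finset.range e,
        Z (a' :: (e - 1 - a') :: a :: (d - 1 - a) :: l) =
      ∑ a ∈ Finset.range e, ∑ a' ∈ Finset.range d,
        Z (a' :: (d - 1 - a') :: a :: (e - 1 - a) :: l) := by
    rw [Finset.sum_comm]
    refine Finset.sum_congr rfl fun a ha => Finset.sum_congr rfl fun a' ha' => ?_
    have ha := Finset.mem_range.1 ha
    have ha' := Finset.mem_range.1 ha'
    refine ih _ _ ?_ (by simp only [weight_cons]; omega)
    exact List.perm_append_comm_assoc [a, e - 1 - a] [a', d - 1 - a'] l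
  have hG := sum_reflect_identity (fun a => Z (a :: (d + e - 1 - a) :: l)) d e (fun a ha => by
    rw [show d + e - 1 - (d + e - 1 - a) = a by omega]
    exact ih _ _ (List.Perm.swap _ _ _) (by simp only [weight_cons]; omega))
  have hs1 : ∑ a ∈ Finset.range d, ((2 * (a : ℚ) + 1) * Z ((a + e) :: (d + e - 1 - (a + e)) :: l)
          + (2 * ((d - 1 - a : ℕ) : ℚ) + 1) * Z (a :: (d + e - 1 - a) :: l)) =
      ∑ a ∈ Finset.range d, ((2 * (a : ℚ) + 1) * Z ((a + e) :: (d - 1 - a) :: l)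
          + (2 * ((d - 1 - a : ℕ) : ℚ) + 1) * Z (a :: (d - 1 - a + e) :: l)) := by
    refine Finset.sum_congr rfl fun a ha => ?_
    have ha := Finset.mem_range.1 ha
    rw [show d + e - 1 - (a + e) = d - 1 - a by omega, show d + e - 1 - a = d - 1 - a + e by omega]
  have hs2 : ∑ a ∈ Finset.range e, ((2 * (a : ℚ) + 1) * Z ((a + d) :: (d + e - 1 - (a + d)) :: l)
          + (2 * ((e - 1 - a : ℕ) : ℚ) + 1) * Z (a :: (d + e - 1 - a) :: l)) =
      ∑ a ∈ Finset.range e, ((2 * (a : ℚ) + 1) * Z ((a + d) :: (e - 1 - a) :: l)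
          + (2 * ((e - 1 - a : ℕ) : ℚ) + 1) * Z (a :: (e - 1 - a + d) :: l)) := by
    refine Finset.sum_congr rfl fun a ha => ?_
    have ha := Finset.mem_range.1 ha
    rw [show d + e - 1 - (a + d) = e - 1 - a by omega, show d + e - 1 - a = e - 1 - a + d by omega]
  simp only [hs1, hs2] at hG
  rw [expand d e (by simp only [weight_cons]; omega), expand e d (by simp only [weight_cons]; omega),
    hquad, add_comm e d, hde]
  linear_combination hG + hc + 2 * Z l * hA

theorem Z_perm {l l' : List ℕ} (h : l.Perm l') : Z l = Z l' := by
  have key : ∀ W, ∀ l l' : List ℕ, l.Perm l' → weight l = W → Z l = Z l' := by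
    intro W
    induction W using Nat.strong_induction_on with
    | _ W ih =>
      have ih' : ∀ l l' : List ℕ, l.Perm l' → weight l < W → Z l = Z l' :=
        fun l l' h hw => ih _ hw l l' h rfl
      intro l l' h
      induction h with
      | nil => intro _; rfl
      | cons x h _ =>
        intro hw
        rw [weight_cons] at hw
        rw [Z_cons, Z_cons, raiseSum_perm h x Z fun t t' ht htw => ih' t t' ht (by omega),
          ih' _ _ h (by omega)]
        congr 3
        refine Finset.sum_congr rfl fun a ha => ?_
        have ha := Finset.mem_range.1 ha
        exact ih' _ _ ((h.cons _).cons _) (by simp only [weight_cons]; omega)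
      | swap x y l =>
        intro hw
        exact Z_swap W ih' y x l hw
      | trans h₁ _ ih₁ ih₂ =>
        intro hw
        rw [ih₁ hw, ih₂ (by rw [← weight_perm h₁]; exact hw)]
  exact key _ l l' h rfl

/-- Invariance of a function on lists under permutations. -/
def PermInvariant (f : Sh) : Prop := ∀ l l' : List ℕ, l.Perm l' → f l = f l'

theorem PermInvariant.der {f : Sh} (hf : PermInvariant f) (s : ℕ) : PermInvariant (Sh.der s f) :=
  fun _ _ h => hf _ _ (h.cons s)

theorem PermInvariant.der_der {f : Sh} (hf : PermInvariant f) (s t : ℕ) :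
    Sh.der s (Sh.der t f) = Sh.der t (Sh.der s f) :=
  funext fun l => hf _ _ (List.Perm.swap s t l)

theorem der_inverse {u v : Sh} (huv : u * v = 1) (s : ℕ) : der s v = -(der s u * v ^ 2) := by
  have h := congrArg (der s) huv
  rw [der_mul, der_one] at h
  linear_combination v * h - der s v * huv

theorem der_inverse_pow {u v : Sh} (huv : u * v = 1) (s n : ℕ) :
    der s (v ^ n) = -((n : Sh) * der s u * v ^ (n + 1)) := by
  induction n with
  | zero => rw [pow_zero, der_one]; simp
  | succ n ih =>
    rw [pow_succ, der_mul, ih, der_inverse huv]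
    push_cast
    ring

theorem der_natCast (s n : ℕ) : der s (n : Sh) = 0 := by
  induction n with
  | zero => simp [der_zero]
  | succ n ih => push_cast; rw [der_add, ih, der_one, add_zero]

theorem natCast_mul_apply (n : ℕ) (f : Sh) (l : List ℕ) : ((n : Sh) * f) l = n * f l := by
  induction n with
  | zero => simp [zero_apply]
  | succ n ih => push_cast; rw [add_mul, add_apply, ih, one_mul]; ring

theorem PermInvariant.mul {f g : Sh} (hf : PermInvariant f) (hg : PermInvariant g) :
    PermInvariant (f * g) := by
  intro l l' h
  induction h generalizing f g with
  | nil => rfl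
  | trans _ _ ih₁ ih₂ => rw [ih₁ hf hg, ih₂ hf hg]
  | @cons x l l' h ih =>
    change Sh.der x (f * g) l = Sh.der x (f * g) l'
    rw [der_mul, add_apply, add_apply, ih (hf.der x) hg, ih hf (hg.der x)]
  | swap x y l =>
    have e : Sh.der x (Sh.der y (f * g)) = Sh.der y (Sh.der x (f * g)) := by
      simp only [der_mul, der_add, hf.der_der x y, hg.der_der x y]
      ring
    exact congrFun e l

/-- Symmetry passes to quotients k / u^n. All exponents are treated together because differentiating
v^n produces v^(n+1). -/
theorem PermInvariant.mul_inverse_pow {u v : Sh} (huv : u * v = 1) (hu : PermInvariant u)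
    {l l' : List ℕ} (h : l.Perm l') :
    ∀ k : Sh, PermInvariant k → ∀ n : ℕ, (k * v ^ n) l = (k * v ^ n) l' := by
  have hder : ∀ (k : Sh) (s n : ℕ), Sh.der s (k * v ^ n) =
      Sh.der s k * v ^ n - (n : Sh) * (k * Sh.der s u * v ^ (n + 1)) := by
    intro k s n
    rw [der_mul, der_inverse_pow huv]; ring
  induction h with
  | nil => intros; rfl
  | trans _ _ ih₁ ih₂ => intro k hk n; rw [ih₁ k hk, ih₂ k hk]
  | swap x y l =>
    intro k hk n
    have e : Sh.der x (Sh.der y (k * v ^ n)) = Sh.der y (Sh.der x (k * v ^ n)) := by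
      simp only [hder, der_sub, der_natCast, hk.der_der x y, der_mul, hu.der_der x y]
      ring
    exact congrFun e l
  | @cons x l l' h ih =>
    intro k hk n
    change Sh.der x (k * v ^ n) l = Sh.der x (k * v ^ n) l'
    rw [hder, Sh.sub_apply, Sh.sub_apply, natCast_mul_apply, natCast_mul_apply, ih _ (hk.der x),
      ih _ (hk.mul (hu.der x))]

/-- Mixed second derivatives of `Z` commute; the product of first derivatives is symmetric anyway,
and the factor `Z` is invertible. -/
theorem B_swap (d e : ℕ) (l : List ℕ) : B (d :: e :: l) = B (e :: d :: l) := by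
  have h2 : ∀ a b : ℕ, der b (der a Z) = (der b (der a freeEnergy)
      + der a freeEnergy * der b freeEnergy) * Z := by
    intro a b
    rw [Z, der_exp, der_mul, der_exp]; ring
  have h3 : der e (der d Z) = der d (der e Z) := funext fun l => Z_perm (List.Perm.swap e d l)
  rw [h2, h2] at h3
  have h4 : der e (der d freeEnergy) = der d (der e freeEnergy) := by
    have hz : Z * Sh.exp (-freeEnergy) = 1 := exp_mul_exp_neg _
    linear_combination (Sh.exp (-freeEnergy)) * h3
      - (der e (der d freeEnergy) - der d (der e freeEnergy)) * hz
  exact congrFun h4 l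

theorem B_perm {l l' : List ℕ} (h : l.Perm l') : B l = B l' := by
  have hZ : PermInvariant Z := fun _ _ h => Z_perm h
  have hz : Z * Sh.exp (-freeEnergy) = 1 := exp_mul_exp_neg _
  -- Logarithmic derivative: der d F is der d Z divided by Z.
  have htail : ∀ (d : ℕ), PermInvariant (der d freeEnergy) := by
    intro d t t' ht
    have e : der d freeEnergy = der d Z * Sh.exp (-freeEnergy) ^ 1 := by
      have h1 : der d Z = der d freeEnergy * Z := der_exp _ d
      rw [h1]
      linear_combination -(der d freeEnergy) * hz
    rw [e]
    exact PermInvariant.mul_inverse_pow hz hZ ht _ (hZ.der d) 1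
  induction h with
  | nil => rfl
  | cons x h _ => exact htail x _ _ h
  | trans _ _ ih₁ ih₂ => exact ih₁.trans ih₂
  | swap x y l => exact B_swap y x l

end BGW

namespace BGWTwoRow
open MvPolynomial
open BGW hiding X C

/-! ### The partition function as a functional on polynomials -/

/-- The linear functional `∏ p_{dᵢ} ↦ Z(d₁, …, dₙ)` on `ℚ[p₀, p₁, …]`. -/
noncomputable def bracket : MvPolynomial ℕ ℚ →ₗ[ℚ] ℚ :=
  (basisMonomials ℕ ℚ).constr ℚ fun m => Z m.toMultiset.toList

theorem prod_map_X (l : List ℕ) :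
    (l.map (X : ℕ → MvPolynomial ℕ ℚ)).prod = monomial (Multiset.toFinsupp (l : Multiset ℕ)) 1 := by
  induction l with
  | nil => simp
  | cons s l ih =>
    rw [List.map_cons, List.prod_cons, ih, X, monomial_mul, one_mul]
    congr 1
    rw [← Multiset.cons_coe, ← Multiset.singleton_add, map_add, Multiset.toFinsupp_singleton]

theorem monomial_eq_prod_map_X (m : ℕ →₀ ℕ) :
    monomial m (1 : ℚ) = (m.toMultiset.toList.map (X : ℕ → MvPolynomial ℕ ℚ)).prod := by
  rw [prod_map_X, Multiset.coe_toList, Finsupp.toMultiset_toFinsupp]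

/-- Permutation invariance of `Z` is what makes the value independent of the order chosen in
`toList`. -/
theorem bracket_prod_map_X (l : List ℕ) :
    bracket (l.map (X : ℕ → MvPolynomial ℕ ℚ)).prod = Z l := by
  rw [prod_map_X, bracket]
  have := (basisMonomials ℕ ℚ).constr_basis ℚ (fun m => Z m.toMultiset.toList)
    (Multiset.toFinsupp (l : Multiset ℕ))
  rw [coe_basisMonomials] at this
  rw [this, Multiset.toFinsupp_toMultiset]
  exact Z_perm (Multiset.coe_eq_coe.1 (Multiset.coe_toList _))

/-- The derivation `p_k ↦ (2k+1) p_{k+d}`. -/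
noncomputable def vir (d : ℕ) : Derivation ℚ (MvPolynomial ℕ ℚ) (MvPolynomial ℕ ℚ) :=
  mkDerivation ℚ fun k => C (2 * (k : ℚ) + 1) * X (k + d)

theorem vir_X (d k : ℕ) : vir d (X k) = C (2 * (k : ℚ) + 1) * X (k + d) := mkDerivation_X _ _ _

/-- The multiplication part of the Virasoro operators. -/
noncomputable def virQuad (d : ℕ) : MvPolynomial ℕ ℚ :=
  C (1 / 2) * ∑ a ∈ Finset.range d, X a * X (d - 1 - a) + C (anomaly d)

theorem bracket_C_mul (c : ℚ) (f : MvPolynomial ℕ ℚ) : bracket (C c * f) = c * bracket f := by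
  rw [C_mul', map_smul, smul_eq_mul]

/-- The prefix p stores the entries already passed, so that the induction can move along the list.
-/
theorem bracket_mul_vir (d : ℕ) (l p : List ℕ) :
    bracket ((p.map X).prod * vir d (l.map X).prod) = raiseSum d l (fun t => Z (p ++ t)) := by
  induction l generalizing p with
  | nil => simp [raiseSum]
  | cons s l ih =>
    have h1 := ih (p ++ [s])
    have h2 := bracket_prod_map_X (p ++ (s + d) :: l)
    simp only [List.map_append, List.map_cons, List.map_nil, List.prod_append, List.prod_cons,
      List.prod_nil, mul_one, List.append_assoc, List.cons_append, List.nil_append] at h1 h2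
    rw [raiseSum, ← h1, ← h2, ← bracket_C_mul, ← map_add, List.map_cons, List.prod_cons,
      Derivation.leibniz, vir_X, smul_eq_mul, smul_eq_mul]
    congr 1
    ring

theorem bracket_X_mul (d : ℕ) (f : MvPolynomial ℕ ℚ) :
    bracket (X d * f) = bracket (vir d f + virQuad d * f) := by
  have h : bracket ∘ₗ LinearMap.mulLeft ℚ (X d) =
      bracket ∘ₗ ((↑(vir d) : MvPolynomial ℕ ℚ →ₗ[ℚ] MvPolynomial ℕ ℚ) + LinearMap.mulLeft ℚ (virQuad d)) := by
    refine (basisMonomials ℕ ℚ).ext fun m => ?_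
    rw [coe_basisMonomials]
    beta_reduce
    rw [monomial_eq_prod_map_X]
    generalize m.toMultiset.toList = l
    have h1 : bracket (X d * (l.map X).prod) = Z (d :: l) := by
      rw [← bracket_prod_map_X]; rfl
    have h2 : ∀ a b : ℕ, bracket (X a * X b * (l.map X).prod) = Z (a :: b :: l) := by
      intro a b
      rw [← bracket_prod_map_X, List.map_cons, List.map_cons, List.prod_cons, List.prod_cons,
        mul_assoc]
    have h3 := bracket_mul_vir d l []
    simp only [List.map_nil, List.prod_nil, one_mul, List.nil_append] at h3
    rw [LinearMap.comp_apply, LinearMap.comp_apply, LinearMap.add_apply, LinearMap.mulLeft_apply,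
      LinearMap.mulLeft_apply, Derivation.coeFn_coe, h1, map_add, h3, Z_cons, virQuad, add_mul, map_add, bracket_C_mul, bracket_prod_map_X,
      mul_assoc, bracket_C_mul, Finset.sum_mul, map_sum, ← add_assoc]
    simp only [h2]
  have h' := LinearMap.congr_fun h f
  rwa [LinearMap.comp_apply, LinearMap.comp_apply, LinearMap.add_apply, LinearMap.mulLeft_apply,
    LinearMap.mulLeft_apply, Derivation.coeFn_coe] at h'

/-! ### Complete symmetric functions -/

/-- The coefficients of `exp (∑ p_k x^(2k+1) / (2k+1))`. -/
noncomputable def completeNat : ℕ → MvPolynomial ℕ ℚ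
  | 0 => 1
  | n + 1 => C (1 / ((n : ℚ) + 1)) * ∑ k : Fin (n / 2 + 1), X (k : ℕ) * completeNat (n - 2 * (k : ℕ))
termination_by n => n
decreasing_by omega

/-- The coefficients of `exp (∑ p_k x^(2k+1) / (2k+1))`, extended by zero to negative indices. -/
noncomputable def complete (n : ℤ) : MvPolynomial ℕ ℚ := if 0 ≤ n then completeNat n.toNat else 0

theorem complete_neg {n : ℤ} (hn : n < 0) : complete n = 0 := if_neg (by omega)

theorem complete_zero : complete 0 = 1 := by simp [complete, completeNat]

theorem complete_natCast (n : ℕ) : complete n = completeNat n := by simp [complete]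

theorem mul_complete (n : ℤ) (M : ℕ) (hM : n ≤ 2 * M) :
    C (n : ℚ) * complete n = ∑ k ∈ Finset.range M, X k * complete (n - 2 * k - 1) := by
  rcases lt_trichotomy n 0 with hn | rfl | hn
  · rw [complete_neg hn, mul_zero, Finset.sum_eq_zero fun k _ => ?_]
    rw [complete_neg (by omega), mul_zero]
  · rw [Int.cast_zero, C_0, zero_mul, Finset.sum_eq_zero fun k _ => ?_]
    rw [complete_neg (by omega), mul_zero]
  · obtain ⟨m, rfl⟩ : ∃ m : ℕ, n = (m + 1 : ℕ) := ⟨n.toNat - 1, by omega⟩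
    rw [complete_natCast, completeNat, ← mul_assoc, ← C_mul]
    have hm : ((m : ℚ) + 1) ≠ 0 := by positivity
    have : (((m + 1 : ℕ) : ℤ) : ℚ) * (1 / ((m : ℚ) + 1)) = 1 := by
      push_cast; field_simp
    rw [this, C_1, one_mul, ← Finset.sum_range (fun k => X k * completeNat (m - 2 * k))]
    have hsub : Finset.range (m / 2 + 1) ⊆ Finset.range M := by
      intro k hk
      simp only [Finset.mem_range] at hk ⊢
      omega
    rw [← Finset.sum_subset hsub]
    · refine Finset.sum_congr rfl fun k hk => ?_
      have := Finset.mem_range.1 hk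
      rw [← complete_natCast]
      congr 2
      omega
    · intro k _ hk
      have := mt Finset.mem_range.2 hk
      rw [complete_neg (by omega), mul_zero]

/-- On generating series, vir d sends log H = ∑ p_k x^(2k+1)/(2k+1) to ∑ p_{k+d} x^(2k+1), and a
derivation satisfies vir d H = H · vir d (log H). Coefficientwise this is proved by differentiating
n h_n = ∑ p_k h_{n-2k-1}. -/
theorem vir_complete (d : ℕ) (n : ℤ) (M : ℕ) (hM : n ≤ 2 * M) :
    vir d (complete n) = ∑ k ∈ Finset.range M, X (k + d) * complete (n - 2 * k - 1) := by
  have main : ∀ N : ℕ, ∀ n : ℤ, n ≤ N → n ≤ 2 * M → vir d (complete n) =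
      ∑ k ∈ Finset.range M, X (k + d) * complete (n - 2 * k - 1) := by
    intro N
    induction N with
    | zero =>
      intro n hn _
      rw [Finset.sum_eq_zero fun k _ => by rw [complete_neg (by omega), mul_zero]]
      rcases hn.lt_or_eq with h | h
      · rw [complete_neg (by omega), map_zero]
      · rw [show n = 0 by omega, complete_zero, Derivation.map_one_eq_zero]
    | succ N ih =>
      intro n hn hM
      by_cases hn' : n ≤ N
      · exact ih n hn' hM
      have hn0 : (n : ℚ) ≠ 0 := by
        have : n ≠ 0 := by omega
        exact_mod_cast this
      have hC : (C (n : ℚ) : MvPolynomial ℕ ℚ) ≠ 0 := by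
        rw [Ne, C_eq_zero]; exact hn0
      refine mul_left_cancel₀ hC ?_
      have h1 : C (n : ℚ) * vir d (complete n) = vir d (C (n : ℚ) * complete n) := by
        rw [C_mul', C_mul', Derivation.map_smul]
      rw [h1, mul_complete n M hM, map_sum]
      have h2 : ∀ k ∈ Finset.range M, vir d (X k * complete (n - 2 * k - 1)) =
          ∑ l ∈ Finset.range M, X k * (X (l + d) * complete (n - 2 * k - 1 - 2 * l - 1))
          + C (2 * (k : ℚ) + 1) * (X (k + d) * complete (n - 2 * k - 1)) := by
        intro k _
        rw [Derivation.leibniz, vir_X, ih _ (by omega) (by omega), smul_eq_mul, smul_eq_mul,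
          Finset.mul_sum]
        ring
      rw [Finset.sum_congr rfl h2, Finset.sum_add_distrib, Finset.sum_comm,
        ← Finset.sum_add_distrib, Finset.mul_sum]
      refine Finset.sum_congr rfl fun k _ => ?_
      have h3 : ∑ l ∈ Finset.range M, X l * (X (k + d) * complete (n - 2 * l - 1 - 2 * k - 1)) =
          X (k + d) * (C ((n - 2 * k - 1 : ℤ) : ℚ) * complete (n - 2 * k - 1)) := by
        rw [mul_complete _ M (by omega), Finset.mul_sum]
        refine Finset.sum_congr rfl fun l _ => ?_
        rw [show n - 2 * (l : ℤ) - 1 - 2 * k - 1 = n - 2 * k - 1 - 2 * l - 1 by ring]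
        ring
      rw [h3]
      push_cast
      rw [C_sub, C_sub, C_mul, C_add, C_mul, C_1]
      ring
  exact main n.toNat n (by omega) hM

theorem sum_sum_add (M : ℕ) (f : ℕ → MvPolynomial ℕ ℚ) (hf : ∀ m, M ≤ m → f m = 0) :
    ∑ k ∈ Finset.range M, ∑ l ∈ Finset.range M, f (k + l) =
      ∑ m ∈ Finset.range M, C ((m : ℚ) + 1) * f m := by
  have h1 : ∀ k ∈ Finset.range M, ∑ l ∈ Finset.range M, f (k + l) =
      ∑ m ∈ Finset.Ico k M, f m := by
    intro k hk
    have hk := Finset.mem_range.1 hk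
    rw [Finset.sum_Ico_eq_sum_range]
    symm
    refine Finset.sum_subset (fun x hx => ?_) fun x _ hx => ?_
    · simp only [Finset.mem_range] at hx ⊢; omega
    · simp only [Finset.mem_range] at hx
      exact hf _ (by omega)
  rw [Finset.sum_congr rfl h1]
  rw [Finset.sum_comm' (t' := Finset.range M) (s' := fun m => Finset.range (m + 1))
    (by intro x y; simp only [Finset.mem_range, Finset.mem_Ico]; omega)]
  refine Finset.sum_congr rfl fun m _ => ?_
  rw [Finset.sum_const, Finset.card_range, nsmul_eq_mul]
  simp

theorem sum_sum_pair (M : ℕ) (f : ℕ → ℕ → MvPolynomial ℕ ℚ)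
    (hf : ∀ a b, M ≤ a + b + 1 → f a b = 0) :
    ∑ k ∈ Finset.range M, ∑ a ∈ Finset.range k, f a (k - 1 - a) =
      ∑ a ∈ Finset.range M, ∑ b ∈ Finset.range M, f a b := by
  rw [Finset.sum_comm' (t' := Finset.range M) (s' := fun a => Finset.Ico (a + 1) M)
    (by intro x y; simp only [Finset.mem_range, Finset.mem_Ico]; omega)]
  refine Finset.sum_congr rfl fun a ha => ?_
  rw [Finset.sum_Ico_eq_sum_range]
  refine Finset.sum_subset_zero_on_sdiff (fun x hx => ?_) (fun x hx => ?_) (fun x hx => ?_)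
  · simp only [Finset.mem_range] at hx ⊢; omega
  · simp only [Finset.mem_sdiff, Finset.mem_range] at hx
    exact hf _ _ (by omega)
  · congr 1; omega

/-- Both double sums collapse by Newton's identity: together they give i(i - 1)/2 times h_{i-1}, and
the anomaly 1/8 completes the square. -/
theorem sum_vir_complete (i : ℤ) (M : ℕ) (hM : i ≤ 2 * M) :
    ∑ k ∈ Finset.range M, (vir k (complete (i - 2 * k - 1)) + virQuad k * complete (i - 2 * k - 1))
      = C (((i : ℚ) - 1 / 2) ^ 2 / 2) * complete (i - 1) := by
  rcases Nat.eq_zero_or_pos M with rfl | hMpos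
  · rw [Finset.range_zero, Finset.sum_empty, complete_neg (by omega), mul_zero]
  have hA : ∑ k ∈ Finset.range M, vir k (complete (i - 2 * k - 1)) =
      ∑ m ∈ Finset.range M, C ((m : ℚ) + 1) * (X m * complete (i - 1 - 2 * m - 1)) := by
    rw [← sum_sum_add M (fun m => X m * complete (i - 1 - 2 * m - 1))]
    · refine Finset.sum_congr rfl fun k _ => ?_
      rw [vir_complete k _ M (by omega)]
      refine Finset.sum_congr rfl fun l _ => ?_
      rw [add_comm l k]
      congr 2
      push_cast; ring
    · intro m hm
      rw [complete_neg (by omega), mul_zero]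
  have hQ : ∑ k ∈ Finset.range M, virQuad k * complete (i - 2 * k - 1) =
      C (1 / 2) * ∑ a ∈ Finset.range M, ∑ b ∈ Finset.range M,
        X a * (X b * complete (i - 1 - 2 * a - 1 - 2 * b - 1)) + C (1 / 8) * complete (i - 1) := by
    rw [← sum_sum_pair M (fun a b => X a * (X b * complete (i - 1 - 2 * a - 1 - 2 * b - 1)))]
    · simp only [virQuad, add_mul, Finset.sum_add_distrib]
      congr 1
      · rw [Finset.mul_sum]
        refine Finset.sum_congr rfl fun k _ => ?_
        rw [mul_assoc, Finset.sum_mul]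
        congr 1
        refine Finset.sum_congr rfl fun a ha => ?_
        have ha := Finset.mem_range.1 ha
        rw [mul_assoc]
        congr 3
        omega
      · obtain ⟨N, rfl⟩ : ∃ N, M = N + 1 := ⟨M - 1, by omega⟩
        rw [Finset.sum_range_succ', Finset.sum_eq_zero]
        · simp [anomaly]
        · intro k _
          simp [anomaly]
    · intro a b hab
      rw [complete_neg (by omega), mul_zero, mul_zero]
  have h1 := mul_complete (i - 1) M (by omega)
  have h2 : ∑ a ∈ Finset.range M, ∑ b ∈ Finset.range M,
        X a * (X b * complete (i - 1 - 2 * a - 1 - 2 * b - 1)) =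
      ∑ a ∈ Finset.range M, C ((i : ℚ) - 2 * a - 2) * (X a * complete (i - 1 - 2 * a - 1)) := by
    refine Finset.sum_congr rfl fun a _ => ?_
    rw [← Finset.mul_sum, ← mul_complete _ M (by omega)]
    push_cast
    rw [show (i : ℚ) - 1 - 2 * a - 1 = i - 2 * a - 2 by ring]
    ring
  have h3 : ∑ m ∈ Finset.range M, C ((m : ℚ) + 1) * (X m * complete (i - 1 - 2 * m - 1))
      + C (1 / 2) * ∑ a ∈ Finset.range M,
        C ((i : ℚ) - 2 * a - 2) * (X a * complete (i - 1 - 2 * a - 1)) =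
      C ((i : ℚ) / 2) * ∑ m ∈ Finset.range M, (X m * complete (i - 1 - 2 * m - 1)) := by
    rw [Finset.mul_sum, Finset.mul_sum, ← Finset.sum_add_distrib]
    refine Finset.sum_congr rfl fun m _ => ?_
    rw [← mul_assoc (C (1 / 2)), ← C_mul, ← add_mul, ← C_add]
    congr 2
    ring
  rw [Finset.sum_add_distrib, hA, hQ, h2, ← add_assoc, h3, ← h1, ← mul_assoc, ← C_mul, ← add_mul,
    ← C_add]
  congr 2
  push_cast
  ring

/-! ### Recursions for the two-row values -/

/-- The two-row values `Z(h_i h_j)`. -/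
noncomputable def pairing (i j : ℤ) : ℚ := bracket (complete i * complete j)

theorem pairing_comm (i j : ℤ) : pairing i j = pairing j i := by
  rw [pairing, pairing, mul_comm]

theorem mul_pairing (i j : ℤ) (M : ℕ) (hM : i ≤ 2 * M) :
    i * pairing i j = ((i : ℚ) - 1 / 2) ^ 2 / 2 * pairing (i - 1) j
      + ∑ k ∈ Finset.range M, bracket (complete (i - 2 * k - 1) * vir k (complete j)) := by
  rw [pairing, pairing, ← bracket_C_mul, ← bracket_C_mul, ← mul_assoc, ← mul_assoc,
    mul_complete i M hM, ← sum_vir_complete i M hM, Finset.sum_mul, Finset.sum_mul, map_sum, map_sum,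
    ← Finset.sum_add_distrib]
  refine Finset.sum_congr rfl fun k _ => ?_
  rw [mul_assoc, bracket_X_mul, ← map_add, Derivation.leibniz, smul_eq_mul, smul_eq_mul]
  congr 1
  ring

theorem mul_pairing_zero (i : ℤ) :
    i * pairing i 0 = ((i : ℚ) - 1 / 2) ^ 2 / 2 * pairing (i - 1) 0 := by
  rw [mul_pairing i 0 i.toNat (by omega), complete_zero, Finset.sum_eq_zero, add_zero]
  intro k _
  rw [Derivation.map_one_eq_zero, mul_zero, map_zero]

/-- The relation vir k h_{j+2} = p_k h_{j+1} + vir (k+1) h_j makes the sums of `mul_pairing` at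
(i+2, j) and (i, j+2) telescope against each other, leaving finitely many terms. -/
theorem pairing_rec (i j : ℤ) :
    ((i : ℚ) + 2) * pairing (i + 2) j - ((i : ℚ) + 3 / 2) ^ 2 / 2 * pairing (i + 1) j
      - (i * pairing i (j + 2) - ((i : ℚ) - 1 / 2) ^ 2 / 2 * pairing (i - 1) (j + 2))
      = j * pairing (i + 1) j - i * pairing i (j + 1) := by
  obtain ⟨M, hi, hj⟩ : ∃ M : ℕ, i + 2 ≤ 2 * M ∧ j + 2 ≤ 2 * M :=
    ⟨i.toNat + j.toNat + 2, by omega, by omega⟩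
  have h1 := mul_pairing (i + 2) j (M + 1) (by omega)
  have h2 := mul_pairing i (j + 2) M (by omega)
  have hj0 : vir 0 (complete j) = C (j : ℚ) * complete j := by
    rw [vir_complete 0 j M (by omega), mul_complete j M (by omega)]
    rfl
  have hstep : ∀ k : ℕ, vir k (complete (j + 2)) =
      X k * complete (j + 1) + vir (k + 1) (complete j) := by
    intro k
    rw [vir_complete k (j + 2) (M + 1) (by omega), Finset.sum_range_succ', add_comm,
      vir_complete (k + 1) j M (by omega)]
    congr 1
    · congr 2
      · simp
      · push_cast; ring
    · refine Finset.sum_congr rfl fun l _ => ?_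
      congr 2
      · ring
      · push_cast; ring
  have h3 : i * pairing i (j + 1) =
      ∑ k ∈ Finset.range M, bracket (complete (i - 2 * k - 1) * (X k * complete (j + 1))) := by
    rw [pairing, ← bracket_C_mul, ← mul_assoc, mul_complete i M (by omega), Finset.sum_mul, map_sum]
    refine Finset.sum_congr rfl fun k _ => ?_
    congr 1; ring
  have h4 : j * pairing (i + 1) j = bracket (complete (i + 1) * vir 0 (complete j)) := by
    rw [hj0, pairing, ← bracket_C_mul]
    congr 1; ring
  rw [Finset.sum_range_succ'] at h1
  simp only [hstep, mul_add, map_add, Finset.sum_add_distrib, ← h3] at h2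
  have e1 : i + 2 - 2 * ((0 : ℕ) : ℤ) - 1 = i + 1 := by push_cast; ring
  have e2 : ∀ k : ℕ, i + 2 - 2 * ((k + 1 : ℕ) : ℤ) - 1 = i - 2 * k - 1 := by
    intro k; push_cast; ring
  simp only [e1, e2, ← h4] at h1
  rw [show i + 2 - 1 = i + 1 by ring] at h1
  push_cast at h1
  linear_combination h1 - h2

end BGWTwoRow

/-! ### Closed form for the differences of two-row values -/

namespace BGWTwoRow
open MvPolynomial
open BGW hiding X C

/-- The coefficients `((2n-1)‼)² / (8ⁿ n!)` of the asymptotic expansion of the Bessel function. -/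
def bessel : ℕ → ℚ
  | 0 => 1
  | n + 1 => (2 * (n : ℚ) + 1) ^ 2 / (8 * ((n : ℚ) + 1)) * bessel n

theorem bessel_succ (n : ℕ) :
    bessel (n + 1) = (2 * (n : ℚ) + 1) ^ 2 / (8 * ((n : ℚ) + 1)) * bessel n := rfl

/-- `Z(h_i h_j)` for natural indices. -/
noncomputable def pair (i j : ℕ) : ℚ := pairing i j

theorem pairing_neg {i : ℤ} (hi : i < 0) (j : ℤ) : pairing i j = 0 := by
  rw [pairing, complete_neg hi, zero_mul, map_zero]

theorem pair_comm (i j : ℕ) : pair i j = pair j i := pairing_comm _ _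

theorem bracket_one : bracket 1 = 1 := by
  have := bracket_prod_map_X []
  rw [List.map_nil, List.prod_nil] at this
  rw [this]
  exact Sh.exp_nil _

theorem pair_zero_right (n : ℕ) : pair n 0 = bessel n := by
  induction n with
  | zero =>
    rw [pair, pairing]
    simp [complete_zero, bracket_one, bessel]
  | succ n ih =>
    have h := mul_pairing_zero (n + 1 : ℕ)
    rw [show ((n + 1 : ℕ) : ℤ) - 1 = n by push_cast; ring] at h
    change _ * pair (n + 1) 0 = _ * pair n 0 at h
    rw [ih] at h
    rw [bessel_succ]
    have hn : ((n : ℚ) + 1) ≠ 0 := by positivity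
    push_cast at h
    field_simp
    linear_combination 8 * h

theorem pair_zero_left (n : ℕ) : pair 0 n = bessel n := by rw [pair_comm, pair_zero_right]

/-- The recursion at i = -1, where all values of negative index vanish. -/
theorem pair_one (j : ℕ) : pair 1 j = ((j : ℚ) + 1 / 8) * bessel j := by
  have h := pairing_rec (-1) j
  rw [pairing_neg (i := -1) (by norm_num), pairing_neg (i := -1) (by norm_num),
    pairing_neg (i := -1 - 1) (by norm_num)] at h
  rw [show (-1 : ℤ) + 2 = 1 by norm_num, show (-1 : ℤ) + 1 = 0 by norm_num] at h
  have h0 : pairing 0 j = bessel j := pair_zero_left j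
  change pairing 1 j = _
  rw [h0] at h
  push_cast at h
  linear_combination h

theorem pair_two (j : ℕ) : 2 * pair 2 j = ((j : ℚ) + 9 / 8) * pair 1 j := by
  have h := pairing_rec 0 j
  rw [pairing_neg (i := 0 - 1) (by norm_num)] at h
  rw [zero_add, zero_add] at h
  change 2 * pairing 2 j = _ * pairing 1 j
  push_cast at h
  linear_combination h

theorem pair_rec (i j : ℕ) :
    ((i : ℚ) + 3) * pair (i + 3) j - ((i : ℚ) + 5 / 2) ^ 2 / 2 * pair (i + 2) j
      - ((i + 1) * pair (i + 1) (j + 2) - ((i : ℚ) + 1 / 2) ^ 2 / 2 * pair i (j + 2))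
      = j * pair (i + 2) j - (i + 1) * pair (i + 1) (j + 1) := by
  have h := pairing_rec (i + 1 : ℕ) j
  rw [show ((i + 1 : ℕ) : ℤ) + 2 = (i + 3 : ℕ) by push_cast; ring,
    show ((i + 1 : ℕ) : ℤ) + 1 = (i + 2 : ℕ) by push_cast; ring,
    show ((i + 1 : ℕ) : ℤ) - 1 = (i : ℕ) by push_cast; ring,
    show (j : ℤ) + 2 = (j + 2 : ℕ) by push_cast; ring,
    show (j : ℤ) + 1 = (j + 1 : ℕ) by push_cast; ring] at h
  change _ * pair (i + 3) j - _ * pair (i + 2) j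
      - (_ * pair (i + 1) (j + 2) - _ * pair i (j + 2))
      = _ * pair (i + 2) j - _ * pair (i + 1) (j + 1) at h
  push_cast at h
  linear_combination h

/-- The differences `Z(h_{i+1} h_j) - Z(h_i h_{j+1})`. -/
def pairDiff (i j : ℕ) : ℚ :=
  bessel i * bessel j * ((j : ℚ) - i) * (4 * (i + 1) * (j + 1) + 1) / (8 * (i + 1) * (j + 1))

/-- Rewriting `pair_rec` through differences leaves exactly 2 Z(h_{i+1} h_{j+2}) - (i + j + 2) Z(h_i
h_{j+2}). The third clause evaluates this remainder, so the three clauses are carried through one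
induction. -/
theorem pair_succ_sub_aux (i : ℕ) :
    (∀ j, pair (i + 1) j - pair i (j + 1) = pairDiff i j) ∧
    (∀ j, pair (i + 2) j - pair (i + 1) (j + 1) = pairDiff (i + 1) j) ∧
    (∀ j : ℕ, 2 * pair (i + 1) j - ((i : ℚ) + j) * pair i j
      = bessel i * bessel j * (j + 1 / (4 * ((i : ℚ) + 1)))) := by
  induction i with
  | zero =>
    refine ⟨fun j => ?_, fun j => ?_, fun j => ?_⟩
    · rw [zero_add, pair_one, pair_zero_left, bessel_succ, pairDiff]
      have hj : ((j : ℚ) + 1) ≠ 0 := by positivity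
      simp only [bessel, Nat.cast_zero]
      field_simp
      ring
    · have h2 := pair_two j
      rw [pair_one] at h2
      rw [zero_add, zero_add, pair_one, bessel_succ, pairDiff]
      have hj : ((j : ℚ) + 1) ≠ 0 := by positivity
      simp only [bessel]
      push_cast
      field_simp
      linear_combination 64 * ((j : ℚ) + 1) * h2
    · rw [zero_add, pair_one, pair_zero_left]
      simp only [bessel]
      push_cast
      ring
  | succ i ih =>
    obtain ⟨hW, hW', hV⟩ := ih
    refine ⟨hW', fun j => ?_, fun j => ?_⟩
    · have e := pair_rec i j
      have w1 := hW' (j + 1)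
      have w2 := hW (j + 1)
      have w3 := hW' j
      have v := hV (j + 2)
      simp only [add_assoc, Nat.reduceAdd] at w1 w2 w3 v e ⊢
      have key : ((i : ℚ) + 3) * (pair (i + 3) j - pair (i + 2) (j + 1)) =
          -((i : ℚ) + 3) * pairDiff (i + 1) (j + 1)
          - bessel i * bessel (j + 2) * ((j : ℚ) + 2 + 1 / (4 * ((i : ℚ) + 1)))
          + (((i : ℚ) + 5 / 2) ^ 2 / 2 + j) * (pairDiff i (j + 1) + pairDiff (i + 1) j)
          - ((i : ℚ) + 1) * pairDiff i (j + 1) := by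
        push_cast at v
        linear_combination e - ((i : ℚ) + 3) * w1 + (((i : ℚ) + 5 / 2) ^ 2 / 2 + j) * (w2 + w3)
          - ((i : ℚ) + 1) * w2 - v
      have hi3 : ((i : ℚ) + 3) ≠ 0 := by positivity
      refine mul_left_cancel₀ hi3 (key.trans ?_)
      have hi1 : ((i : ℚ) + 1) ≠ 0 := by positivity
      have hi2 : ((i : ℚ) + 2) ≠ 0 := by positivity
      have hi2' : ((i : ℚ) + 1 + 1) ≠ 0 := by positivity
      have hi3' : ((i : ℚ) + 2 + 1) ≠ 0 := by positivity
      have hj1 : ((j : ℚ) + 1) ≠ 0 := by positivity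
      have hj2' : ((j : ℚ) + 1 + 1) ≠ 0 := by positivity
      simp only [pairDiff, bessel_succ]
      push_cast
      field_simp
      ring
    · have w1 := hW' j
      have w2 := hW j
      have v := hV (j + 1)
      have key : 2 * pair (i + 1 + 1) j - (((i + 1 : ℕ) : ℚ) + j) * pair (i + 1) j =
          bessel i * bessel (j + 1) * ((j : ℚ) + 1 + 1 / (4 * ((i : ℚ) + 1)))
          + 2 * pairDiff (i + 1) j - ((i : ℚ) + 1 + j) * pairDiff i j := by
        push_cast at v ⊢
        linear_combination v + 2 * w1 - ((i : ℚ) + 1 + j) * w2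
      rw [key]
      have hi1 : ((i : ℚ) + 1) ≠ 0 := by positivity
      have hi2' : ((i : ℚ) + 1 + 1) ≠ 0 := by positivity
      have hj1 : ((j : ℚ) + 1) ≠ 0 := by positivity
      simp only [pairDiff, bessel_succ]
      push_cast
      field_simp
      ring

/-- In this form the difference equals that of the product array b_i b_j, up to the explicit
correction (i - j) b_i b_j. -/
theorem pair_succ_sub (i j : ℕ) :
    pair (i + 1) j - pair i (j + 1) =
      bessel (i + 1) * bessel j - bessel i * bessel (j + 1)
      - ((i : ℚ) - j) * (bessel i * bessel j) := by
  rw [(pair_succ_sub_aux i).1 j, pairDiff, bessel_succ, bessel_succ]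
  have hi1 : ((i : ℚ) + 1) ≠ 0 := by positivity
  have hj1 : ((j : ℚ) + 1) ≠ 0 := by positivity
  field_simp
  ring

end BGWTwoRow

namespace BGWTwoRow
open BGW hiding X C
open PowerSeries

/-! ### The Euler operator on power series -/

section Euler

variable {R : Type*} [CommRing R]

/-- The Euler operator `x d/dx` on power series. -/
noncomputable def euler (f : R⟦X⟧) : R⟦X⟧ := X * d⁄dX R f

theorem coeff_euler (f : R⟦X⟧) (n : ℕ) : coeff n (euler f) = n * coeff n f := by
  cases n with
  | zero => simp [euler]
  | succ n =>
    rw [euler, coeff_succ_X_mul, coeff_derivative]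
    push_cast; ring

theorem euler_mul (f g : R⟦X⟧) : euler (f * g) = euler f * g + f * euler g := by
  rw [euler, Derivation.leibniz, smul_eq_mul, smul_eq_mul, euler, euler]; ring

theorem euler_add (f g : R⟦X⟧) : euler (f + g) = euler f + euler g := by
  rw [euler, map_add, mul_add, euler, euler]

theorem euler_sub (f g : R⟦X⟧) : euler (f - g) = euler f - euler g := by
  rw [euler, map_sub, mul_sub, euler, euler]

theorem euler_evalNegHom (f : R⟦X⟧) : euler (evalNegHom f) = evalNegHom (euler f) := by
  ext n
  simp only [coeff_euler, evalNegHom, coeff_rescale]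
  ring

end Euler

/-! ### Power sums in terms of complete symmetric functions -/

/-- The generating series of the complete symmetric functions. -/
noncomputable def completeSeries : (MvPolynomial ℕ ℚ)⟦X⟧ := mk completeNat

/-- The generating series `∑ p_k x^(2k+1)`. -/
noncomputable def powerSeries : (MvPolynomial ℕ ℚ)⟦X⟧ :=
  mk fun n => if Odd n then MvPolynomial.X (n / 2) else 0

theorem euler_completeSeries : euler completeSeries = powerSeries * completeSeries := by
  ext1 n
  rw [coeff_euler, coeff_mul, completeSeries, powerSeries, coeff_mk]
  have h := mul_complete n n (by omega)
  rw [complete_natCast] at h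
  simp only [coeff_mk]
  have h' : (n : MvPolynomial ℕ ℚ) = MvPolynomial.C ((n : ℤ) : ℚ) := by simp
  rw [h', h, Finset.Nat.sum_antidiagonal_eq_sum_range_succ
    (fun i j => (if Odd i then MvPolynomial.X (i / 2) else 0) * completeNat j)]
  symm
  rw [← Finset.sum_filter_of_ne (p := Odd)]
  swap
  · intro i _ hi
    by_contra hodd
    simp [hodd] at hi
  have hs : ∑ k ∈ Finset.range n, MvPolynomial.X k * complete (n - 2 * k - 1) =
      ∑ k ∈ (Finset.range n).filter (fun k => 2 * k + 1 ≤ n),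
        MvPolynomial.X k * complete ((n : ℤ) - 2 * k - 1) := by
    symm
    refine Finset.sum_filter_of_ne fun k _ hk => ?_
    by_contra hlt
    exact hk (by rw [complete_neg (by omega), mul_zero])
  rw [hs]
  refine Finset.sum_nbij' (fun i => i / 2) (fun k => 2 * k + 1) ?_ ?_ ?_ ?_ ?_
  · intro i hi
    simp only [Finset.mem_filter, Finset.mem_range] at hi ⊢
    obtain ⟨h1, m, rfl⟩ := hi
    omega
  · intro k hk
    simp only [Finset.mem_filter, Finset.mem_range] at hk ⊢
    exact ⟨by omega, k, rfl⟩
  · intro i hi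
    simp only [Finset.mem_filter, Finset.mem_range] at hi
    obtain ⟨h1, m, rfl⟩ := hi
    omega
  · intro k _
    omega
  · intro i hi
    simp only [Finset.mem_filter, Finset.mem_range] at hi
    rw [if_pos hi.2, ← complete_natCast]
    obtain ⟨h1, m, rfl⟩ := hi
    congr 2
    omega

theorem evalNegHom_powerSeries : evalNegHom powerSeries = -powerSeries := by
  ext1 n
  rw [evalNegHom, coeff_rescale, map_neg, powerSeries, coeff_mk]
  split_ifs with h
  · rw [h.neg_one_pow]; ring
  · simp

/-- Only odd powers occur in log H, so H(-x) = 1/H(x). -/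
theorem completeSeries_mul_neg : completeSeries * evalNegHom completeSeries = 1 := by
  have h : euler (completeSeries * evalNegHom completeSeries) = 0 := by
    rw [euler_mul, euler_evalNegHom, euler_completeSeries, map_mul, evalNegHom_powerSeries]; ring
  ext1 n
  have hn := congrArg (coeff n) h
  rw [coeff_euler, map_zero, mul_eq_zero] at hn
  rcases n with _ | n
  · rw [evalNegHom, coeff_mul, Finset.Nat.antidiagonal_zero, Finset.sum_singleton, coeff_rescale,
      completeSeries, coeff_mk, completeNat]
    simp
  · rw [hn.resolve_left (by exact_mod_cast (Nat.succ_ne_zero n)), coeff_one, if_neg (by omega)]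

/-- Coefficient of x^(2k+1) in P(x) = x H'(x)/H(x) = x H'(x) H(-x). -/
theorem X_eq_sum_complete (k : ℕ) :
    (MvPolynomial.X k : MvPolynomial ℕ ℚ) = ∑ p ∈ Finset.HasAntidiagonal.antidiagonal (2 * k + 1),
      MvPolynomial.C ((-1 : ℚ) ^ p.2 * p.1) * (completeNat p.1 * completeNat p.2) := by
  have h : powerSeries = euler completeSeries * evalNegHom completeSeries := by
    rw [euler_completeSeries, mul_assoc, completeSeries_mul_neg, mul_one]
  have h2 := congrArg (coeff (2 * k + 1)) h
  rw [coeff_mul, powerSeries, coeff_mk, if_pos ⟨k, rfl⟩, show (2 * k + 1) / 2 = k by omega] at h2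
  rw [h2]
  refine Finset.sum_congr rfl fun p _ => ?_
  rw [coeff_euler, evalNegHom, coeff_rescale, completeSeries, coeff_mk, coeff_mk]
  simp only [map_mul, map_pow, map_neg, map_one, map_natCast]
  ring

theorem Z_singleton (k : ℕ) : Z [k] = B [k] := by
  have h := congrFun (Sh.der_exp freeEnergy k) []
  rw [Sh.mul_nil, Sh.exp_nil, mul_one] at h
  exact h

theorem B_singleton_eq_sum (k : ℕ) :
    B [k] = ∑ p ∈ Finset.HasAntidiagonal.antidiagonal (2 * k + 1), (-1 : ℚ) ^ p.2 * p.1 * pair p.1 p.2 := by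
  have h := bracket_prod_map_X [k]
  rw [List.map_cons, List.map_nil, List.prod_cons, List.prod_nil, mul_one, Z_singleton,
    X_eq_sum_complete, map_sum] at h
  rw [← h]
  refine Finset.sum_congr rfl fun p _ => ?_
  rw [bracket_C_mul, pair, pairing, complete_natCast, complete_natCast]

/-- Summation by parts. With the weight i + 1/2, each interior F(i, j) receives (i - 1/2) + (i +
1/2) = 2i, so alternating sums weighted by i are expressed through differences. -/
theorem sum_antidiagonal_diff (F : ℕ → ℕ → ℚ) (k : ℕ) :
    ∑ p ∈ Finset.HasAntidiagonal.antidiagonal (2 * k),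
        (-1 : ℚ) ^ p.2 * (p.1 + 1 / 2) * (F (p.1 + 1) p.2 - F p.1 (p.2 + 1)) =
      2 * ∑ p ∈ Finset.HasAntidiagonal.antidiagonal (2 * k + 1), (-1 : ℚ) ^ p.2 * p.1 * F p.1 p.2
        - 1 / 2 * F 0 (2 * k + 1) - (2 * k + 3 / 2) * F (2 * k + 1) 0 := by
  have h1 := Finset.Nat.sum_antidiagonal_succ (n := 2 * k)
    (f := fun p => (-1 : ℚ) ^ p.2 * (p.1 - 1 / 2) * F p.1 p.2)
  have h2 := Finset.Nat.sum_antidiagonal_succ' (n := 2 * k)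
    (f := fun p => (-1 : ℚ) ^ p.2 * (p.1 + 1 / 2) * F p.1 p.2)
  have h3 : ∑ p ∈ Finset.HasAntidiagonal.antidiagonal (2 * k + 1), (-1 : ℚ) ^ p.2 * (p.1 - 1 / 2) * F p.1 p.2
      + ∑ p ∈ Finset.HasAntidiagonal.antidiagonal (2 * k + 1), (-1 : ℚ) ^ p.2 * (p.1 + 1 / 2) * F p.1 p.2
      = 2 * ∑ p ∈ Finset.HasAntidiagonal.antidiagonal (2 * k + 1), (-1 : ℚ) ^ p.2 * p.1 * F p.1 p.2 := by
    rw [← Finset.sum_add_distrib, Finset.mul_sum]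
    exact Finset.sum_congr rfl fun p _ => by ring
  have h4 : ∑ p ∈ Finset.HasAntidiagonal.antidiagonal (2 * k),
        (-1 : ℚ) ^ p.2 * (p.1 + 1 / 2) * (F (p.1 + 1) p.2 - F p.1 (p.2 + 1)) =
      ∑ p ∈ Finset.HasAntidiagonal.antidiagonal (2 * k), (-1 : ℚ) ^ p.2 * (((p.1 + 1 : ℕ) : ℚ) - 1 / 2)
        * F (p.1 + 1) p.2
      + ∑ p ∈ Finset.HasAntidiagonal.antidiagonal (2 * k), (-1 : ℚ) ^ (p.2 + 1) * ((p.1 : ℚ) + 1 / 2)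
        * F p.1 (p.2 + 1) := by
    rw [← Finset.sum_add_distrib]
    refine Finset.sum_congr rfl fun p _ => ?_
    push_cast; ring
  have hodd : (-1 : ℚ) ^ (2 * k + 1) = -1 := Odd.neg_one_pow ⟨k, rfl⟩
  simp only [hodd] at h1
  push_cast at h1 h2 h4
  rw [h4]
  linear_combination -h1 - h2 + h3

/-! ### The generating series of the Bessel coefficients -/

/-- The generating series of the Bessel coefficients. -/
noncomputable def besselSeries : ℚ⟦X⟧ := mk bessel

theorem coeff_ofNat_mul (m : ℕ) [m.AtLeastTwo] (f : ℚ⟦X⟧) (n : ℕ) :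
    coeff n ((OfNat.ofNat m : ℚ⟦X⟧) * f) = (OfNat.ofNat m : ℚ) * coeff n f := by
  rw [show (OfNat.ofNat m : ℚ⟦X⟧) = PowerSeries.C (OfNat.ofNat m : ℚ) from
    (map_ofNat PowerSeries.C m).symm, coeff_C_mul]

theorem euler_besselSeries : 8 * euler besselSeries =
    X * (4 * euler (euler besselSeries) + 4 * euler besselSeries + besselSeries) := by
  ext n
  rcases n with _ | n
  · rw [coeff_ofNat_mul, coeff_euler]; simp
  · rw [coeff_ofNat_mul, coeff_succ_X_mul, map_add, map_add, coeff_ofNat_mul, coeff_ofNat_mul]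
    simp only [coeff_euler, besselSeries, coeff_mk, bessel_succ]
    have : ((n : ℚ) + 1) ≠ 0 := by positivity
    push_cast
    field_simp
    ring

theorem euler_besselSeries_neg : 8 * euler (evalNegHom besselSeries) =
    -(X * (4 * euler (euler (evalNegHom besselSeries)) + 4 * euler (evalNegHom besselSeries)
      + evalNegHom besselSeries)) := by
  have h := congrArg evalNegHom euler_besselSeries
  simp only [map_mul, map_add, map_ofNat, evalNegHom_X, ← euler_evalNegHom] at h
  rw [h]; ring

/-- The product `y(x) y(-x)` of the Bessel series. -/
noncomputable def besselSq : ℚ⟦X⟧ := besselSeries * evalNegHom besselSeries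

/-- The Wronskian of `y(x)` and `y(-x)`. -/
noncomputable def besselWr : ℚ⟦X⟧ :=
  euler besselSeries * evalNegHom besselSeries - besselSeries * euler (evalNegHom besselSeries)

/-- The product of the derivatives of `y(x)` and `y(-x)`. -/
noncomputable def besselDD : ℚ⟦X⟧ := euler besselSeries * euler (evalNegHom besselSeries)

/-- The differential equations for y(x) and y(-x) have right-hand sides of opposite sign.
Multiplying each by the other function and adding gives this relation; subtracting gives
`coeff_besselSq_rec`, and multiplying by derivatives gives `coeff_besselDD`. -/
theorem coeff_besselWr (n : ℕ) : coeff n besselWr = 2 * coeff (n + 1) besselSq := by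
  have h : X * (4 * euler besselWr + 4 * besselWr) = 8 * euler besselSq := by
    rw [besselWr, besselSq, euler_sub, euler_mul, euler_mul, euler_mul]
    linear_combination -(evalNegHom besselSeries) * euler_besselSeries
      - besselSeries * euler_besselSeries_neg
  have h' := congrArg (coeff (n + 1)) h
  rw [coeff_succ_X_mul, map_add, coeff_ofNat_mul, coeff_ofNat_mul, coeff_ofNat_mul, coeff_euler,
    coeff_euler] at h'
  have hn : ((n : ℚ) + 1) ≠ 0 := by positivity
  push_cast at h'
  refine mul_left_cancel₀ hn ?_
  linear_combination h' / 4

theorem coeff_besselDD (n : ℕ) : 4 * ((n : ℚ) + 2) * coeff n besselDD = -n * coeff n besselSq := by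
  have h : X * (4 * euler besselDD + 8 * besselDD + euler besselSq) = 0 := by
    rw [besselDD, besselSq, euler_mul, euler_mul]
    linear_combination -(euler (evalNegHom besselSeries)) * euler_besselSeries
      + euler besselSeries * euler_besselSeries_neg
  have h' := congrArg (coeff (n + 1)) h
  rw [coeff_succ_X_mul, map_add, map_add, coeff_ofNat_mul, coeff_ofNat_mul, coeff_euler,
    coeff_euler, map_zero] at h'
  linear_combination h'

theorem coeff_besselSq_rec (n : ℕ) :
    4 * ((n : ℚ) + 2) * coeff (n + 2) besselSq = ((n : ℚ) + 1) ^ 3 * coeff n besselSq := by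
  have h : X * (4 * euler (euler besselSq) + 4 * euler besselSq + 2 * besselSq - 8 * besselDD) =
      8 * besselWr := by
    rw [besselWr, besselSq, besselDD, euler_mul, euler_add, euler_mul, euler_mul]
    linear_combination -(evalNegHom besselSeries) * euler_besselSeries
      + besselSeries * euler_besselSeries_neg
  have h' := congrArg (coeff (n + 1)) h
  rw [coeff_succ_X_mul, map_sub, map_add, map_add, coeff_ofNat_mul, coeff_ofNat_mul,
    coeff_ofNat_mul, coeff_ofNat_mul, coeff_ofNat_mul, coeff_euler, coeff_euler,
    coeff_besselWr] at h'
  linear_combination -((n : ℚ) + 2) / 4 * h' - coeff_besselDD n / 2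

theorem coeff_besselSq_odd (k : ℕ) : coeff (2 * k + 1) besselSq = 0 := by
  induction k with
  | zero =>
    have h := coeff_besselWr 0
    have h0 : coeff 0 besselWr = 0 := by
      simp [besselWr, euler]
    rw [h0] at h
    linarith
  | succ k ih =>
    have h := coeff_besselSq_rec (2 * k + 1)
    rw [ih, mul_zero] at h
    have : (4 * (((2 * k + 1 : ℕ) : ℚ) + 2)) ≠ 0 := by positivity
    exact (mul_eq_zero.1 h).resolve_left this

/-- The one-point numbers. -/
theorem B_singleton (k : ℕ) : (2 * (k : ℚ) + 1) * B [k] = coeff (2 * k + 2) besselSq := by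
  -- The two arrays have equal boundary values, so subtracting the two summations by parts cancels
  -- the boundary terms and leaves B(k) in terms of Bessel products.
  have h1 := sum_antidiagonal_diff pair k
  have h2 := sum_antidiagonal_diff (fun i j => bessel i * bessel j) k
  rw [← B_singleton_eq_sum, pair_zero_left, pair_zero_right] at h1
  have hneg : ∀ n, coeff n (evalNegHom besselSeries) = (-1 : ℚ) ^ n * bessel n := by
    intro n
    rw [evalNegHom, coeff_rescale, besselSeries, coeff_mk]
  have h3 : ∑ p ∈ Finset.HasAntidiagonal.antidiagonal (2 * k + 1), (-1 : ℚ) ^ p.2 * p.1 * (bessel p.1 * bessel p.2)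
      = coeff (2 * k + 1) (euler besselSeries * evalNegHom besselSeries) := by
    rw [coeff_mul]
    refine Finset.sum_congr rfl fun p _ => ?_
    rw [coeff_euler, hneg, besselSeries, coeff_mk]; ring
  have h4 : ∑ p ∈ Finset.HasAntidiagonal.antidiagonal (2 * k), (-1 : ℚ) ^ p.2 * (p.1 + 1 / 2)
        * (((p.1 : ℚ) - p.2) * (bessel p.1 * bessel p.2))
      = coeff (2 * k) (euler (euler besselSeries) * evalNegHom besselSeries - besselDD)
        + 1 / 2 * coeff (2 * k) besselWr := by
    rw [besselDD, besselWr, map_sub, map_sub, coeff_mul, coeff_mul, coeff_mul, coeff_mul,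
      ← Finset.sum_sub_distrib, ← Finset.sum_sub_distrib, Finset.mul_sum, ← Finset.sum_add_distrib]
    refine Finset.sum_congr rfl fun p _ => ?_
    simp only [coeff_euler, hneg]
    simp only [besselSeries, coeff_mk]
    ring
  have h5 : ∑ p ∈ Finset.HasAntidiagonal.antidiagonal (2 * k),
        (-1 : ℚ) ^ p.2 * (p.1 + 1 / 2) * (pair (p.1 + 1) p.2 - pair p.1 (p.2 + 1)) =
      ∑ p ∈ Finset.HasAntidiagonal.antidiagonal (2 * k), (-1 : ℚ) ^ p.2 * (p.1 + 1 / 2)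
        * (bessel (p.1 + 1) * bessel p.2 - bessel p.1 * bessel (p.2 + 1))
      - ∑ p ∈ Finset.HasAntidiagonal.antidiagonal (2 * k), (-1 : ℚ) ^ p.2 * (p.1 + 1 / 2)
        * (((p.1 : ℚ) - p.2) * (bessel p.1 * bessel p.2)) := by
    rw [← Finset.sum_sub_distrib]
    refine Finset.sum_congr rfl fun p _ => ?_
    rw [pair_succ_sub]; ring
  have e1 : 2 * (euler besselSeries * evalNegHom besselSeries) = euler besselSq + besselWr := by
    rw [besselSq, besselWr, euler_mul]; ring
  have e2 : 2 * (euler (euler besselSeries) * evalNegHom besselSeries - besselDD) =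
      euler (euler besselSq) + euler besselWr - 4 * besselDD := by
    rw [besselSq, besselWr, besselDD, euler_mul, euler_add, euler_sub, euler_mul, euler_mul]
    ring
  have f1 := congrArg (coeff (2 * k + 1)) e1
  have f2 := congrArg (coeff (2 * k)) e2
  rw [coeff_ofNat_mul, map_add, coeff_euler, coeff_besselWr, coeff_besselSq_odd] at f1
  rw [coeff_ofNat_mul, map_sub _ (_ + _), map_add, coeff_euler, coeff_euler, coeff_euler, coeff_ofNat_mul,
    coeff_besselWr, coeff_besselSq_odd] at f2
  rw [coeff_besselWr, coeff_besselSq_odd] at h4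
  have hq := coeff_besselDD (2 * k)
  have hs := coeff_besselSq_rec (2 * k)
  rw [h3] at h2
  rw [h5, h2, h4] at h1
  simp only [bessel] at h1
  push_cast at *
  have hk : ((k : ℚ) + 1) ≠ 0 := by positivity
  have hk8 : (8 * ((k : ℚ) + 1)) ≠ 0 := by positivity
  refine mul_left_cancel₀ hk8 ?_
  linear_combination -4 * ((k : ℚ) + 1) * (2 * k + 1) * h1
    + 4 * ((k : ℚ) + 1) * (2 * k + 1) * f1 - 2 * ((k : ℚ) + 1) * (2 * k + 1) * f2
    + (2 * (k : ℚ) + 1) * hq + 2 * (k : ℚ) * hs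

end BGWTwoRow

namespace BGW
open BGWTwoRow (besselSq)

/-! ### Normalized numbers -/

/-- The normalized BGW numbers, as a function on lists. -/
noncomputable def nc (l : List ℕ) : ℝ :=
  2 ^ (2 * l.sum + 1) * (B l : ℝ) / ((weight l - 1).factorial : ℝ)

theorem weight_eq (l : List ℕ) : weight l = 2 * l.sum + l.length := by
  induction l with
  | nil => rfl
  | cons s l ih => rw [weight_cons, ih, List.sum_cons, List.length_cons]; ring

theorem nc_perm {l l' : List ℕ} (h : l.Perm l') : nc l = nc l' := by
  rw [nc, nc, B_perm h, weight_perm h, h.sum_eq]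

theorem shuffle_nonneg (l : List ℕ) (f g : List ℕ → ℚ)
    (hf : ∀ t, weight t ≤ weight l → 0 ≤ f t) (hg : ∀ t, weight t ≤ weight l → 0 ≤ g t) :
    0 ≤ shuffle l f g := by
  rw [shuffle_eq_sum]
  exact Finset.sum_nonneg fun I _ =>
    mul_nonneg (hf _ (weight_subseq_le l I)) (hg _ (weight_subseq_le l Iᶜ))

theorem raiseSum_nonneg (d : ℕ) (l : List ℕ) (f : List ℕ → ℚ)
    (hf : ∀ t, weight t = weight l + 2 * d → 0 ≤ f t) : 0 ≤ raiseSum d l f := by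
  rw [raiseSum_eq_sum]
  exact Finset.sum_nonneg fun i _ => mul_nonneg (by positivity) (hf _ (weight_set l i d))

theorem B_nonneg (l : List ℕ) : 0 ≤ B l := by
  have key : ∀ W, ∀ l : List ℕ, weight l = W → 0 ≤ B l := by
    intro W
    induction W using Nat.strong_induction_on with
    | _ W ih =>
      intro l hl
      cases l with
      | nil => rw [B]
      | cons d l =>
        rw [weight_cons] at hl
        rw [B_cons]
        refine add_nonneg (add_nonneg ?_ ?_) (by split_ifs <;> norm_num)
        · exact raiseSum_nonneg _ _ _ fun t ht => ih _ (by omega) t rfl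
        · refine mul_nonneg (by norm_num) (Finset.sum_nonneg fun a ha => ?_)
          have ha := Finset.mem_range.1 ha
          refine add_nonneg (ih _ ?_ _ rfl) (shuffle_nonneg _ _ _ (fun t ht => ih _ ?_ _ rfl)
            (fun t ht => ih _ ?_ _ rfl)) <;> simp only [weight_cons] <;> omega
  exact key _ l rfl

theorem nc_nonneg (l : List ℕ) : 0 ≤ nc l := by
  have : (0 : ℝ) ≤ B l := by exact_mod_cast B_nonneg l
  unfold nc
  positivity

theorem B_eq_nc (l : List ℕ) :
    (B l : ℝ) = nc l * ((weight l - 1).factorial : ℝ) / 2 ^ (2 * l.sum + 1) := by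
  have h1 : ((weight l - 1).factorial : ℝ) ≠ 0 := by positivity
  rw [nc]
  field_simp

theorem raiseSum_zero (l : List ℕ) (f : List ℕ → ℚ) : raiseSum 0 l f = weight l * f l := by
  induction l generalizing f with
  | nil => simp [raiseSum, weight]
  | cons s l ih =>
    rw [raiseSum, ih, weight_cons, add_zero]
    push_cast; ring

/-- For d = 0 only the first sum survives, with total coefficient X(l), which is the factor gained
by the factorial. -/
theorem nc_zero_cons (l : List ℕ) (hl : l ≠ []) : nc (0 :: l) = nc l := by
  have hB : B (0 :: l) = weight l * B l := by
    rw [B_cons, raiseSum_zero]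
    simp [hl]
  have hw : 0 < weight l := by
    rw [weight_eq]
    have := List.length_pos_iff.2 hl
    omega
  obtain ⟨w, hw'⟩ : ∃ w, weight l = w + 1 := ⟨weight l - 1, by omega⟩
  rw [nc, nc, hB, weight_cons, List.sum_cons, hw']
  simp only [mul_zero, zero_add, Nat.add_sub_cancel, Nat.add_sub_cancel_left, Nat.factorial_succ]
  push_cast
  have : ((w : ℝ) + 1) ≠ 0 := by positivity
  have : (w.factorial : ℝ) ≠ 0 := by positivity
  field_simp

theorem nc_singleton_zero : nc [0] = 1 / 4 := by
  rw [nc, B]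
  norm_num [weight]

/-! ### One-point numbers -/

theorem B_singleton_succ (k : ℕ) :
    8 * ((k : ℚ) + 2) * B [k + 1] = (2 * (k : ℚ) + 3) ^ 2 * (2 * k + 1) * B [k] := by
  have h1 := BGWTwoRow.B_singleton k
  have h2 := BGWTwoRow.B_singleton (k + 1)
  have h3 := BGWTwoRow.coeff_besselSq_rec (2 * k + 2)
  rw [show 2 * (k + 1) + 2 = 2 * k + 2 + 2 by ring] at h2
  rw [← h1, ← h2] at h3
  push_cast at h3
  have : (2 * (k : ℚ) + 3) ≠ 0 := by positivity
  refine mul_left_cancel₀ this ?_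
  linear_combination h3

theorem nc_singleton_succ (k : ℕ) :
    nc [k + 1] = (2 * (k : ℝ) + 3) ^ 2 / ((2 * k + 2) * (2 * k + 4)) * nc [k] := by
  have h : 8 * ((k : ℝ) + 2) * B [k + 1] = (2 * (k : ℝ) + 3) ^ 2 * (2 * k + 1) * B [k] := by
    exact_mod_cast B_singleton_succ k
  have e1 : weight [k + 1] - 1 = 2 * k + 2 := by simp [weight]; ring
  have e2 : weight [k] - 1 = 2 * k := by simp [weight]
  rw [nc, nc, e1, e2, Nat.factorial_succ, Nat.factorial_succ, List.sum_singleton,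
    List.sum_singleton, show 2 * (k + 1) + 1 = 2 * k + 1 + 2 by ring, pow_add]
  have : ((2 * k).factorial : ℝ) ≠ 0 := by positivity
  have hB : (B [k + 1] : ℝ) =
      (2 * (k : ℝ) + 3) ^ 2 * (2 * k + 1) * B [k] / (8 * ((k : ℝ) + 2)) := by
    field_simp
    linear_combination h
  rw [hB]
  push_cast
  field_simp
  ring

/-- The Wallis product tends to π/2 and the right side to 1/2, whence the limit 1/π. -/
theorem nc_singleton_mul_wallis (k : ℕ) :
    nc [k] * Real.Wallis.W k = (2 * (k : ℝ) + 1) / (2 * (2 * k + 2)) := by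
  induction k with
  | zero => rw [nc_singleton_zero]; norm_num [Real.Wallis.W]
  | succ k ih =>
    rw [nc_singleton_succ, Real.Wallis.W_succ]
    have : nc [k] * Real.Wallis.W k * ((2 * (k : ℝ) + 3) ^ 2 / ((2 * k + 2) * (2 * k + 4)) *
        ((2 * k + 2) / (2 * k + 1) * ((2 * k + 2) / (2 * k + 3)))) =
        (2 * ((k + 1 : ℕ) : ℝ) + 1) / (2 * (2 * ((k + 1 : ℕ) : ℝ) + 2)) := by
      rw [ih]
      push_cast
      field_simp
      ring
    rw [← this]
    ring

theorem abs_nc_singleton_sub (k : ℕ) : |nc [k] - 1 / Real.pi| ≤ 1 / ((k : ℝ) + 1) := by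
  have h := nc_singleton_mul_wallis k
  have hW := Real.Wallis.W_pos k
  have h1 := Real.Wallis.le_W k
  have h2 := Real.Wallis.W_le k
  have hpi := Real.pi_gt_three
  have hnc : nc [k] = (2 * (k : ℝ) + 1) / (2 * (2 * k + 2)) / Real.Wallis.W k := by
    rw [← h]; field_simp
  have hup : nc [k] ≤ 1 / Real.pi := by
    rw [hnc, div_le_iff₀ hW]
    calc (2 * (k : ℝ) + 1) / (2 * (2 * k + 2))
        = 1 / Real.pi * ((2 * (k : ℝ) + 1) / (2 * k + 2) * (Real.pi / 2)) := by field_simp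
      _ ≤ _ := by gcongr
  have hlo : (2 * (k : ℝ) + 1) / (2 * k + 2) / Real.pi ≤ nc [k] := by
    rw [hnc, le_div_iff₀ hW]
    calc (2 * (k : ℝ) + 1) / (2 * k + 2) / Real.pi * Real.Wallis.W k
        ≤ (2 * (k : ℝ) + 1) / (2 * k + 2) / Real.pi * (Real.pi / 2) := by gcongr
      _ = _ := by field_simp
  rw [abs_le]
  constructor
  · have : (2 * (k : ℝ) + 1) / (2 * k + 2) / Real.pi =
        1 / Real.pi - 1 / (2 * Real.pi * (k + 1)) := by field_simp; ring
    have h3 : 1 / (2 * Real.pi * ((k : ℝ) + 1)) ≤ 1 / ((k : ℝ) + 1) := by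
      apply one_div_le_one_div_of_le (by positivity)
      nlinarith [(Nat.cast_nonneg k : (0 : ℝ) ≤ k)]
    linarith
  · have : (0 : ℝ) ≤ 1 / ((k : ℝ) + 1) := by positivity
    linarith

/-! ### The recursion for the normalized numbers -/

theorem sum_subseq_add (l : List ℕ) (I : Finset (Fin l.length)) :
    (subseq l I).length = I.card ∧ (subseq l I).sum + (subseq l Iᶜ).sum = l.sum := by
  have hsum : ∀ J : Finset (Fin l.length), (subseq l J).sum = ∑ i ∈ J, l.get i := by
    intro J
    rw [subseq, ← List.sum_toFinset _ ((List.nodup_finRange _).filter _)]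
    congr 1
    ext i
    simp
  constructor
  · rw [subseq, List.length_map, ← List.toFinset_card_of_nodup ((List.nodup_finRange _).filter _)]
    congr 1
    ext i
    simp
  · rw [hsum, hsum, Finset.sum_add_sum_compl]
    simp [Fin.sum_univ_getElem]

/-- The quadratic term of the recursion, multiplied by `X - 1`. -/
noncomputable def quadTerm (d : ℕ) (l : List ℕ) : ℝ :=
  ∑ a ∈ Finset.range d, ∑ I : Finset (Fin l.length),
    ((weight (a :: subseq l I) - 1).factorial : ℝ)
      * ((weight ((d - 1 - a) :: subseq l Iᶜ) - 1).factorial : ℝ)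
      / ((weight (d :: l) - 2).factorial : ℝ)
      * (nc (a :: subseq l I) * nc ((d - 1 - a) :: subseq l Iᶜ))

/-- The linear coefficients total X(l) + 2d = X(d, l) - 1. The 2 before the splitting sum is 1/2
times 4, since splitting lowers the genus by one. -/
theorem nc_cons (d : ℕ) (l : List ℕ) (h : ¬(d = 0 ∧ l = [])) :
    ((weight (d :: l) : ℝ) - 1) * nc (d :: l) =
      ∑ i : Fin l.length, (2 * (l.get i : ℝ) + 1) * nc (l.set i (l.get i + d))
      + 2 * ∑ a ∈ Finset.range d, nc (a :: (d - 1 - a) :: l) + quadTerm d l := by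
  have hB : (B (d :: l) : ℝ) =
      ∑ i : Fin l.length, (2 * (l.get i : ℝ) + 1) * (B (l.set i (l.get i + d)) : ℝ)
      + 1 / 2 * ∑ a ∈ Finset.range d, (B (a :: (d - 1 - a) :: l) : ℝ)
      + 1 / 2 * ∑ a ∈ Finset.range d, ∑ I : Finset (Fin l.length),
          (B (a :: subseq l I) : ℝ) * (B ((d - 1 - a) :: subseq l Iᶜ) : ℝ) := by
    rw [B_cons, if_neg h, raiseSum_eq_sum, add_zero, Finset.sum_add_distrib]
    simp only [shuffle_eq_sum]
    push_cast
    ring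
  have hX : 2 ≤ weight (d :: l) := by
    rw [weight_cons, weight_eq]
    rcases Nat.eq_zero_or_pos d with hd | hd
    · have : l ≠ [] := fun hl => h ⟨hd, hl⟩
      have := List.length_pos_iff.2 this
      omega
    · omega
  obtain ⟨w, hw⟩ : ∃ w, weight (d :: l) = w + 2 := ⟨weight (d :: l) - 2, by omega⟩
  have hw' : 2 * d + 1 + weight l = w + 2 := by rw [← weight_cons, hw]
  have hwl := weight_eq l
  have hpow : (2 : ℝ) ^ (2 * (d :: l).sum + 1) ≠ 0 := by positivity
  have hfac : (w.factorial : ℝ) ≠ 0 := by positivity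
  have h0 : ((weight (d :: l) : ℝ) - 1) * nc (d :: l) =
      2 ^ (2 * (d + l.sum) + 1) / (w.factorial : ℝ) * B (d :: l) := by
    rw [nc, hw, show w + 2 - 1 = w + 1 by omega, Nat.factorial_succ, List.sum_cons]
    have : ((w : ℝ) + 1) ≠ 0 := by positivity
    push_cast
    field_simp
    ring
  rw [h0, hB, mul_add, mul_add]
  congr 1
  · congr 1
    · rw [Finset.mul_sum]
      refine Finset.sum_congr rfl fun i _ => ?_
      have e1 := weight_set l i d
      have e2 : (l.set i (l.get i + d)).sum = d + l.sum := by
        have := weight_eq (l.set i (l.get i + d))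
        rw [e1, List.length_set] at this
        omega
      rw [nc, e1, e2, show weight l + 2 * d - 1 = w by omega]
      ring
    · rw [← mul_assoc, Finset.mul_sum, Finset.mul_sum]
      refine Finset.sum_congr rfl fun a ha => ?_
      have ha := Finset.mem_range.1 ha
      have e1 : weight (a :: (d - 1 - a) :: l) - 1 = w := by simp only [weight_cons]; omega
      have e2 : 2 * (d + l.sum) + 1 = (2 * (a :: (d - 1 - a) :: l).sum + 1) + 2 := by
        simp only [List.sum_cons]; omega
      rw [nc, e1, e2, pow_add]
      ring
  · rw [quadTerm, ← mul_assoc, Finset.mul_sum]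
    refine Finset.sum_congr rfl fun a ha => ?_
    rw [Finset.mul_sum]
    refine Finset.sum_congr rfl fun I _ => ?_
    have ha := Finset.mem_range.1 ha
    have hs := (sum_subseq_add l I).2
    have e2 : 2 * (d + l.sum) + 1 = (2 * (a :: subseq l I).sum + 1)
        + (2 * ((d - 1 - a) :: subseq l Iᶜ).sum + 1) + 1 := by
      simp only [List.sum_cons]; omega
    rw [B_eq_nc (a :: _), B_eq_nc ((d - 1 - a) :: _), hw, show w + 2 - 2 = w by omega]
    rw [e2, pow_succ, pow_add]
    field_simp

end BGW

namespace BGW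

/-! ### Bounds for binomial coefficients -/

theorem mul_add_one_le_choose (p q : ℕ) : p * q + 1 ≤ (p + q).choose p := by
  have key : ∀ N p q : ℕ, p + q = N → p * q + 1 ≤ (p + q).choose p := by
    intro N
    induction N with
    | zero => intro p q h; obtain ⟨rfl, rfl⟩ : p = 0 ∧ q = 0 := by omega
              simp
    | succ N ih =>
      intro p q h
      rcases p with _ | p
      · simp
      rcases q with _ | q
      · simp
      have h1 := ih p (q + 1) (by omega)
      have h2 := ih (p + 1) q (by omega)
      have e : (p + 1 + (q + 1)).choose (p + 1) =
          (p + (q + 1)).choose p + (p + 1 + q).choose (p + 1) := by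
        rw [show p + 1 + (q + 1) = (p + (q + 1)) + 1 by ring, Nat.choose_succ_succ,
          show p + (q + 1) = p + 1 + q by ring]
      rw [e]
      nlinarith [Nat.zero_le (p * q)]
  exact key _ p q rfl

theorem choose_mul_choose_le (m n i j : ℕ) :
    m.choose i * n.choose j ≤ (m + n).choose (i + j) := by
  rw [Nat.add_choose_eq]
  exact Finset.single_le_sum (f := fun ij : ℕ × ℕ => m.choose ij.1 * n.choose ij.2)
    (fun _ _ => Nat.zero_le _) ((Finset.HasAntidiagonal.mem_antidiagonal (a := (i, j))).2 rfl)

/-- By Vandermonde the square of the binomial (p + q choose p) is at most (2p + 2q choose 2p), and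
each factor is at least p q + 1. -/
theorem mul_mul_le_choose (p q : ℕ) (hp : 1 ≤ p) (hq : 1 ≤ q) :
    (p + 1) * (q + 1) * (p + q) ≤ 2 * (2 * p + 2 * q).choose (2 * p) := by
  have h1 := choose_mul_choose_le (p + q) (p + q) p p
  rw [show p + q + (p + q) = 2 * p + 2 * q by ring, show p + p = 2 * p by ring] at h1
  have h2 := mul_add_one_le_choose p q
  obtain ⟨p, rfl⟩ : ∃ r, p = r + 1 := ⟨p - 1, by omega⟩
  obtain ⟨q, rfl⟩ : ∃ r, q = r + 1 := ⟨q - 1, by omega⟩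
  have h3 : (p + 1 + 1) * (q + 1 + 1) ≤ 2 * ((p + 1) * (q + 1) + 1) := by
    nlinarith [Nat.zero_le (p * q)]
  have h4 : p + 1 + (q + 1) ≤ (p + 1) * (q + 1) + 1 := by nlinarith [Nat.zero_le (p * q)]
  calc (p + 1 + 1) * (q + 1 + 1) * (p + 1 + (q + 1))
      ≤ 2 * ((p + 1) * (q + 1) + 1) * ((p + 1) * (q + 1) + 1) := Nat.mul_le_mul h3 h4
    _ ≤ 2 * ((p + 1 + (q + 1)).choose (p + 1) * (p + 1 + (q + 1)).choose (p + 1)) := by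
        rw [mul_assoc]
        exact Nat.mul_le_mul le_rfl (Nat.mul_le_mul h2 h2)
    _ ≤ _ := Nat.mul_le_mul le_rfl h1

theorem sum_inv_choose_card (n : ℕ) :
    ∑ I : Finset (Fin n), 1 / ((n.choose I.card : ℕ) : ℝ) = n + 1 := by
  rw [← Finset.powerset_univ,
    Finset.sum_powerset_apply_card (fun k => 1 / ((n.choose k : ℕ) : ℝ)), Finset.card_univ,
    Fintype.card_fin]
  have : ∀ k ∈ Finset.range (n + 1), n.choose k • (1 / ((n.choose k : ℕ) : ℝ)) = 1 := by
    intro k hk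
    have hk := Finset.mem_range.1 hk
    have : (0 : ℝ) < n.choose k := by exact_mod_cast Nat.choose_pos (by omega)
    rw [nsmul_eq_mul]
    field_simp
  rw [Finset.sum_congr rfl this]
  simp

theorem subseq_empty (l : List ℕ) : subseq l ∅ = [] := by simp [subseq]

theorem subseq_univ (l : List ℕ) : subseq l Finset.univ = l := by simp [subseq]

theorem eq_empty_of_sum_subseq (l : List ℕ) (hl : ∀ s ∈ l, 1 ≤ s) (I : Finset (Fin l.length))
    (h : (subseq l I).sum = 0) : I = ∅ := by
  rw [← Finset.card_eq_zero, ← (sum_subseq_add l I).1]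
  have hmem : ∀ s ∈ subseq l I, 1 ≤ s := by
    intro s hs
    simp only [subseq, List.mem_map] at hs
    obtain ⟨i, -, rfl⟩ := hs
    exact hl _ (List.get_mem l i)
  have := List.length_le_sum_of_one_le _ hmem
  omega

theorem factorial_ratio (x y : ℕ) : ((x.factorial : ℝ) * y.factorial) / ((x + y + 1).factorial : ℝ)
    = 1 / ((x + y + 1 : ℕ) : ℝ) * (1 / ((x + y).choose x : ℝ)) := by
  have h := Nat.add_choose_mul_factorial_mul_factorial x y
  rw [← Nat.choose_symm_add] at h
  have h' : ((x + y).choose x : ℝ) * x.factorial * y.factorial = (x + y).factorial := by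
    exact_mod_cast h
  rw [Nat.factorial_succ]
  push_cast
  rw [← h']
  have h1 : ((x + y).choose x : ℝ) ≠ 0 := by
    exact_mod_cast (Nat.choose_pos (by omega)).ne'
  have h2 : (x.factorial : ℝ) ≠ 0 := by positivity
  have h3 : (y.factorial : ℝ) ≠ 0 := by positivity
  have h4 : ((x : ℝ) + y + 1) ≠ 0 := by positivity
  field_simp

/-! ### The quadratic term -/

theorem quadTerm_nonneg (d : ℕ) (l : List ℕ) : 0 ≤ quadTerm d l := by
  refine Finset.sum_nonneg fun a _ => Finset.sum_nonneg fun I _ => ?_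
  have h1 := nc_nonneg (a :: subseq l I)
  have h2 := nc_nonneg ((d - 1 - a) :: subseq l Iᶜ)
  positivity

/-- Let p and q be the sums of the two parts. As the entries of l are positive, p = 0 or q = 0
forces one part to be the sequence (0), with value 1/4, and the other to be (d - 1, l). Otherwise
Vandermonde splits off the factor 1/(|l| choose |I|), and the remaining binomial beats the product
of the linear bounds. -/
theorem quad_summand_le (d : ℕ) (l : List ℕ) (hl : ∀ s ∈ l, 1 ≤ s) (M : ℝ)
    (hM : nc ((d - 1) :: l) ≤ M)
    (hlin : ∀ t, t ≠ [] → weight t < weight (d :: l) → nc t ≤ ((t.sum : ℝ) + 1) / 4)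
    (a : ℕ) (ha : a < d) (I : Finset (Fin l.length)) :
    ((weight (a :: subseq l I) - 1).factorial : ℝ)
      * ((weight ((d - 1 - a) :: subseq l Iᶜ) - 1).factorial : ℝ)
      / ((weight (d :: l) - 2).factorial : ℝ)
      * (nc (a :: subseq l I) * nc ((d - 1 - a) :: subseq l Iᶜ)) ≤
    1 / ((weight (d :: l) : ℝ) - 2) * ((if a = 0 then if I = ∅ then M / 4 else 0 else 0)
      + (if a = d - 1 then if I = Finset.univ then M / 4 else 0 else 0)
      + 1 / (4 * ((d : ℝ) + l.sum)) * (1 / (l.length.choose I.card : ℝ))) := by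
  obtain ⟨hlen, hsum⟩ := sum_subseq_add l I
  have hlen' := (sum_subseq_add l Iᶜ).1
  have hcard : I.card + Iᶜ.card = l.length := by
    rw [Finset.card_add_card_compl, Fintype.card_fin]
  set p := a + (subseq l I).sum with hp
  set q := (d - 1 - a) + (subseq l Iᶜ).sum with hq
  have hpq : p + q + 1 = d + l.sum := by omega
  have hw1 : weight (a :: subseq l I) - 1 = 2 * p + I.card := by
    rw [weight_cons, weight_eq, hlen]; omega
  have hw2 : weight ((d - 1 - a) :: subseq l Iᶜ) - 1 = 2 * q + Iᶜ.card := by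
    rw [weight_cons, weight_eq, hlen']; omega
  have hw : weight (d :: l) = 2 * p + I.card + (2 * q + Iᶜ.card) + 1 + 2 := by
    rw [weight_cons, weight_eq]; omega
  have hwR : (weight (d :: l) : ℝ) - 2 =
      ((2 * p + I.card + (2 * q + Iᶜ.card) + 1 : ℕ) : ℝ) := by
    rw [hw]; push_cast; ring
  have hM0 : 0 ≤ M := (nc_nonneg _).trans hM
  rw [hw1, hw2, hw, Nat.add_sub_cancel, factorial_ratio, ← hw, hwR, mul_assoc]
  refine mul_le_mul_of_nonneg_left ?_ (by positivity)
  have hchoose : l.length.choose I.card * (2 * p + 2 * q).choose (2 * p) ≤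
      (2 * p + I.card + (2 * q + Iᶜ.card)).choose (2 * p + I.card) := by
    have := choose_mul_choose_le (2 * p + 2 * q) l.length (2 * p) I.card
    rw [mul_comm]
    rwa [show 2 * p + 2 * q + l.length = 2 * p + I.card + (2 * q + Iᶜ.card) by omega] at this
  have hc0 : (0 : ℝ) < l.length.choose I.card := by
    exact_mod_cast Nat.choose_pos (by omega)
  have ht1 : (0 : ℝ) ≤ if a = 0 then if I = ∅ then M / 4 else 0 else 0 := by
    split_ifs <;> positivity
  have ht2 : (0 : ℝ) ≤ if a = d - 1 then if I = Finset.univ then M / 4 else 0 else 0 := by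
    split_ifs <;> positivity
  have ht3 : (0 : ℝ) ≤ 1 / (4 * ((d : ℝ) + l.sum)) * (1 / (l.length.choose I.card : ℝ)) := by
    positivity
  rcases Nat.eq_zero_or_pos p with hp0 | hp0
  · have ha0 : a = 0 := by omega
    have hI : I = ∅ := eq_empty_of_sum_subseq l hl I (by omega)
    subst hI
    subst ha0
    rw [if_pos rfl, if_pos rfl]
    have : 1 / (((2 * p + (∅ : Finset (Fin l.length)).card
        + (2 * q + (∅ᶜ : Finset (Fin l.length)).card)).choose
        (2 * p + (∅ : Finset (Fin l.length)).card) : ℕ) : ℝ) = 1 := by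
      rw [hp0]; simp
    rw [this, one_mul, subseq_empty, Finset.compl_empty, subseq_univ, nc_singleton_zero,
      Nat.sub_zero]
    linarith
  rcases Nat.eq_zero_or_pos q with hq0 | hq0
  · have ha0 : a = d - 1 := by omega
    have hI : Iᶜ = ∅ := eq_empty_of_sum_subseq l hl Iᶜ (by omega)
    have hI' : I = Finset.univ := by rwa [Finset.compl_eq_empty_iff] at hI
    have : 1 / (((2 * p + I.card + (2 * q + Iᶜ.card)).choose (2 * p + I.card) : ℕ) : ℝ) = 1 := by
      rw [hq0, hI]; simp
    rw [this, one_mul, hI, hI', subseq_univ, subseq_empty, if_pos rfl, if_pos ha0,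
      show d - 1 - a = 0 by omega, nc_singleton_zero, ha0]
    rw [hI', ha0] at ht1
    rw [hI'] at ht3
    linarith
  · have hn1 : nc (a :: subseq l I) ≤ ((p : ℝ) + 1) / 4 := by
      have := hlin (a :: subseq l I) (by simp) (by omega)
      rwa [List.sum_cons] at this
    have hn2 : nc ((d - 1 - a) :: subseq l Iᶜ) ≤ ((q : ℝ) + 1) / 4 := by
      have := hlin ((d - 1 - a) :: subseq l Iᶜ) (by simp) (by omega)
      rwa [List.sum_cons] at this
    have hbin := mul_mul_le_choose p q hp0 hq0
    have hbinR : ((p : ℝ) + 1) * (q + 1) * (p + q) ≤ 2 * ((2 * p + 2 * q).choose (2 * p) : ℝ) := by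
      exact_mod_cast hbin
    have hchooseR : (l.length.choose I.card : ℝ) * ((2 * p + 2 * q).choose (2 * p) : ℝ) ≤
        ((2 * p + I.card + (2 * q + Iᶜ.card)).choose (2 * p + I.card) : ℝ) := by
      exact_mod_cast hchoose
    have hb0 : (0 : ℝ) < ((2 * p + 2 * q).choose (2 * p) : ℝ) := by
      exact_mod_cast Nat.choose_pos (by omega)
    have hpR : (1 : ℝ) ≤ p := by exact_mod_cast hp0
    have hqR : (1 : ℝ) ≤ q := by exact_mod_cast hq0
    have hprod : nc (a :: subseq l I) * nc ((d - 1 - a) :: subseq l Iᶜ) ≤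
        ((p : ℝ) + 1) / 4 * (((q : ℝ) + 1) / 4) :=
      mul_le_mul hn1 hn2 (nc_nonneg _) (by positivity)
    have hdl : (d : ℝ) + l.sum = p + q + 1 := by exact_mod_cast hpq.symm
    have hmain : 1 / (((2 * p + I.card + (2 * q + Iᶜ.card)).choose (2 * p + I.card) : ℕ) : ℝ)
        * (nc (a :: subseq l I) * nc ((d - 1 - a) :: subseq l Iᶜ)) ≤
        1 / (4 * ((d : ℝ) + l.sum)) * (1 / (l.length.choose I.card : ℝ)) := by
      calc _ ≤ 1 / ((l.length.choose I.card : ℝ) * ((2 * p + 2 * q).choose (2 * p) : ℝ))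
            * (((p : ℝ) + 1) / 4 * (((q : ℝ) + 1) / 4)) := by
            gcongr
            exact mul_nonneg (nc_nonneg _) (nc_nonneg _)
        _ = (((p : ℝ) + 1) * (q + 1) / (16 * ((2 * p + 2 * q).choose (2 * p) : ℝ)))
            * (1 / (l.length.choose I.card : ℝ)) := by
            field_simp
            ring
        _ ≤ _ := by
            refine mul_le_mul_of_nonneg_right ?_ (by positivity)
            rw [hdl, div_le_div_iff₀ (by positivity) (by positivity)]
            nlinarith [mul_nonneg (by positivity : (0 : ℝ) ≤ ((p : ℝ) + 1) * (q + 1))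
              (by linarith : (0 : ℝ) ≤ (p : ℝ) + q - 1)]
    linarith

/-- The two extreme summands give M/4 each. In the rest, the inverse binomials sum to |l| + 1, and
minimality of d bounds d (|l| + 1)/(d + sum of l) by 1. -/
theorem quadTerm_le (d : ℕ) (l : List ℕ) (hd : 1 ≤ d) (hl : ∀ s ∈ l, 1 ≤ s) (M : ℝ)
    (hM : nc ((d - 1) :: l) ≤ M)
    (hlin : ∀ t, t ≠ [] → weight t < weight (d :: l) → nc t ≤ ((t.sum : ℝ) + 1) / 4)
    (hmin : d * (l.length + 1) ≤ d + l.sum) :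
    quadTerm d l ≤ (M / 2 + 1 / 4) / ((weight (d :: l) : ℝ) - 2) := by
  have h1 : quadTerm d l ≤ ∑ a ∈ Finset.range d, ∑ I : Finset (Fin l.length),
    1 / ((weight (d :: l) : ℝ) - 2) * ((if a = 0 then if I = ∅ then M / 4 else 0 else 0)
      + (if a = d - 1 then if I = Finset.univ then M / 4 else 0 else 0)
      + 1 / (4 * ((d : ℝ) + l.sum)) * (1 / (l.length.choose I.card : ℝ))) :=
    Finset.sum_le_sum fun a ha => Finset.sum_le_sum fun I _ =>
      quad_summand_le d l hl M hM hlin a (Finset.mem_range.1 ha) I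
  refine h1.trans ?_
  simp only [← Finset.mul_sum, Finset.sum_add_distrib, sum_inv_choose_card, Finset.sum_const,
    Finset.card_range, nsmul_eq_mul]
  have hw : (0 : ℝ) < (weight (d :: l) : ℝ) - 2 := by
    have : 3 ≤ weight (d :: l) := by rw [weight_cons]; omega
    have : (3 : ℝ) ≤ weight (d :: l) := by exact_mod_cast this
    linarith
  have e1 : ∑ a ∈ Finset.range d, ∑ I : Finset (Fin l.length),
      (if a = 0 then if I = ∅ then M / 4 else 0 else 0) = M / 4 := by
    rw [Finset.sum_eq_single_of_mem 0 (Finset.mem_range.2 (by omega))]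
    · simp
    · intro a _ ha; simp [ha]
  have e2 : ∑ a ∈ Finset.range d, ∑ I : Finset (Fin l.length),
      (if a = d - 1 then if I = Finset.univ then M / 4 else 0 else 0) = M / 4 := by
    rw [Finset.sum_eq_single_of_mem (d - 1) (Finset.mem_range.2 (by omega))]
    · simp
    · intro a _ ha; simp [ha]
  rw [e1, e2, one_div, inv_mul_eq_div]
  refine div_le_div_of_nonneg_right ?_ hw.le
  have hminR : (d : ℝ) * (l.length + 1) ≤ d + l.sum := by exact_mod_cast hmin
  have hpos : (0 : ℝ) < (d : ℝ) + l.sum := by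
    have : (1 : ℝ) ≤ d := by exact_mod_cast hd
    positivity
  have e3 : (d : ℝ) * (1 / (4 * ((d : ℝ) + l.sum)) * ((l.length : ℝ) + 1)) ≤ 1 / 4 := by
    rw [show (d : ℝ) * (1 / (4 * ((d : ℝ) + l.sum)) * ((l.length : ℝ) + 1)) =
      ((d : ℝ) * (l.length + 1)) / (4 * ((d : ℝ) + l.sum)) by ring,
      div_le_div_iff₀ (by positivity) (by norm_num)]
    linarith
  linarith

/-! ### The averaging inequality -/

theorem abs_nc_cons_sub_le (d : ℕ) (l : List ℕ) (h : ¬(d = 0 ∧ l = [])) (c U V : ℝ)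
    (hU : ∀ i : Fin l.length, |nc (l.set i (l.get i + d)) - c| ≤ U)
    (hV : ∀ a < d, |nc (a :: (d - 1 - a) :: l) - c| ≤ V) :
    ((weight (d :: l) : ℝ) - 1) * |nc (d :: l) - c| ≤
      weight l * U + 2 * d * V + quadTerm d l := by
  have hrec := nc_cons d l h
  have hwl : (weight l : ℝ) = ∑ i : Fin l.length, (2 * (l.get i : ℝ) + 1) := by
    have h1 := raiseSum_zero l (fun _ => 1)
    rw [raiseSum_eq_sum] at h1
    simp only [mul_one] at h1
    have h2 : ((∑ i : Fin l.length, (2 * (l.get i : ℚ) + 1) : ℚ) : ℝ) = ((weight l : ℚ) : ℝ) := by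
      rw [h1]
    push_cast at h2
    exact h2.symm
  have hw : (weight (d :: l) : ℝ) - 1 = weight l + 2 * d := by
    rw [weight_cons]; push_cast; ring
  have hw0 : 0 ≤ (weight (d :: l) : ℝ) - 1 := by rw [hw]; positivity
  have hdiff : ((weight (d :: l) : ℝ) - 1) * (nc (d :: l) - c) =
      ∑ i : Fin l.length, (2 * (l.get i : ℝ) + 1) * (nc (l.set i (l.get i + d)) - c)
      + 2 * ∑ a ∈ Finset.range d, (nc (a :: (d - 1 - a) :: l) - c) + quadTerm d l := by
    simp only [mul_sub, Finset.sum_sub_distrib, ← Finset.sum_mul, ← hwl, hrec, Finset.sum_const,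
      Finset.card_range, nsmul_eq_mul]
    rw [hw]
    ring
  rw [← abs_of_nonneg hw0, ← abs_mul, hdiff]
  refine (abs_add_le _ _).trans (add_le_add ((abs_add_le _ _).trans (add_le_add ?_ ?_)) ?_)
  · refine (Finset.abs_sum_le_sum_abs _ _).trans ?_
    rw [hwl, Finset.sum_mul]
    refine Finset.sum_le_sum fun i _ => ?_
    rw [abs_mul, abs_of_nonneg (by positivity : (0 : ℝ) ≤ 2 * (l.get i : ℝ) + 1)]
    exact mul_le_mul_of_nonneg_left (hU i) (by positivity)
  · rw [abs_mul, abs_two, mul_assoc]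
    refine mul_le_mul_of_nonneg_left ?_ (by norm_num)
    refine (Finset.abs_sum_le_sum_abs _ _).trans ?_
    refine (Finset.sum_le_sum fun a ha => hV a (Finset.mem_range.1 ha)).trans ?_
    simp
  · rw [abs_of_nonneg (quadTerm_nonneg d l)]

theorem exists_perm_min_cons (l : List ℕ) (hl : l ≠ []) :
    ∃ d t, l.Perm (d :: t) ∧ d * (t.length + 1) ≤ d + t.sum := by
  obtain ⟨d, hd, hmin⟩ := l.toFinset.exists_min_image id (by
    obtain ⟨a, ha⟩ := List.exists_mem_of_ne_nil l hl
    exact ⟨a, List.mem_toFinset.2 ha⟩)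
  have hd' := List.mem_toFinset.1 hd
  refine ⟨d, l.erase d, List.perm_cons_erase hd', ?_⟩
  have h := List.card_nsmul_le_sum (l.erase d) d
    (fun x hx => hmin x (List.mem_toFinset.2 (List.mem_of_mem_erase hx)))
  rw [smul_eq_mul] at h
  linarith [mul_comm (l.erase d).length d, mul_add d (l.erase d).length 1]

theorem sum_set (l : List ℕ) (i : Fin l.length) (d : ℕ) :
    (l.set i (l.get i + d)).sum = l.sum + d := by
  have h1 := weight_set l i d
  rw [weight_eq, weight_eq, List.length_set] at h1
  omega

/-- The a priori bound `C ≤ g / 4`. -/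
theorem nc_le_linear (l : List ℕ) (hl : l ≠ []) : nc l ≤ ((l.sum : ℝ) + 1) / 4 := by
  have key : ∀ W, ∀ l : List ℕ, weight l = W → l ≠ [] → nc l ≤ ((l.sum : ℝ) + 1) / 4 := by
    intro W
    induction W using Nat.strong_induction_on with
    | _ W ih =>
      intro l hW hl
      by_cases h0 : 0 ∈ l
      · have hp := List.perm_cons_erase h0
        rw [nc_perm hp, hp.sum_eq, List.sum_cons, zero_add]
        by_cases he : l.erase 0 = []
        · rw [he, nc_singleton_zero]; norm_num
        · rw [nc_zero_cons _ he]
          refine ih _ ?_ _ rfl he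
          rw [← hW, weight_perm hp, weight_cons]
          omega
      · obtain ⟨d, t, hp, hmin⟩ := exists_perm_min_cons l hl
        have hpos : ∀ s ∈ d :: t, 1 ≤ s := by
          intro s hs
          have : s ≠ 0 := fun h => h0 (hp.mem_iff.2 (h ▸ hs))
          omega
        have hd : 1 ≤ d := hpos d (by simp)
        have ht : ∀ s ∈ t, 1 ≤ s := fun s hs => hpos s (by simp [hs])
        have hW' : weight (d :: t) = W := by rw [← weight_perm hp, hW]
        have hlin : ∀ s, s ≠ [] → weight s < weight (d :: t) → nc s ≤ ((s.sum : ℝ) + 1) / 4 :=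
          fun s hs hw => ih _ (by omega) s rfl hs
        rw [nc_perm hp, hp.sum_eq]
        have hwc := weight_cons d t
        have hM : nc ((d - 1) :: t) ≤ ((d : ℝ) + t.sum) / 4 := by
          have := hlin ((d - 1) :: t) (by simp) (by simp only [weight_cons]; omega)
          rw [List.sum_cons] at this
          rw [Nat.cast_add, Nat.cast_sub hd, Nat.cast_one] at this
          linarith
        have hq := quadTerm_le d t hd ht _ hM hlin hmin
        -- Centre 0: merging keeps the genus and splitting lowers it by one, hence the two bounds.
        have havg := abs_nc_cons_sub_le d t (by omega) 0 (((d : ℝ) + t.sum + 1) / 4)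
          (((d : ℝ) + t.sum) / 4)
          (fun i => by
            rw [sub_zero, abs_of_nonneg (nc_nonneg _)]
            have hne : t.set i (t.get i + d) ≠ [] := by
              rw [← List.length_pos_iff, List.length_set]
              exact i.pos
            have := hlin _ hne (by rw [weight_set, weight_cons]; omega)
            rw [sum_set, Nat.cast_add] at this
            linarith)
          (fun a ha => by
            rw [sub_zero, abs_of_nonneg (nc_nonneg _)]
            have := hlin (a :: (d - 1 - a) :: t) (by simp) (by simp only [weight_cons]; omega)
            have e : (a :: (d - 1 - a) :: t).sum + 1 = d + t.sum := by
              simp only [List.sum_cons]; omega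
            have e' : ((a :: (d - 1 - a) :: t).sum : ℝ) + 1 = d + t.sum := by exact_mod_cast e
            rw [e'] at this
            exact this)
        rw [sub_zero, abs_of_nonneg (nc_nonneg _)] at havg
        have hX : (weight (d :: t) : ℝ) = 2 * ((d : ℝ) + t.sum) + (t.length + 1) := by
          rw [weight_eq]; simp only [List.sum_cons, List.length_cons, Nat.cast_add, Nat.cast_mul, Nat.cast_one,
            Nat.cast_ofNat]
        have hwt : (weight t : ℝ) = weight (d :: t) - 1 - 2 * d := by
          rw [weight_cons]; push_cast; ring
        have hdR : (1 : ℝ) ≤ d := by exact_mod_cast hd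
        have hts : (0 : ℝ) ≤ t.sum := by positivity
        have htl : (0 : ℝ) ≤ t.length := by positivity
        -- The splitting terms have total weight 2d and save 1/4 each; this gain d/2 pays for the
        -- quadratic term.
        have hq2 : quadTerm d t ≤ d / 2 := by
          refine hq.trans ?_
          rw [div_le_iff₀ (by linarith)]
          nlinarith
        rw [List.sum_cons]
        have hX1 : (0 : ℝ) < (weight (d :: t) : ℝ) - 1 := by linarith
        refine le_of_mul_le_mul_left ?_ hX1
        refine havg.trans ?_
        rw [hwt, Nat.cast_add]
        linarith
  exact key _ l rfl hl

end BGW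

namespace BGW

/-! ### The comparison function -/

/-- The comparison function for the distance of the normalized numbers to `1 / π`. -/
noncomputable def psi (m n : ℝ) : ℝ := (2 - 1 / n) / m + 8 * n / m ^ 2

theorem psi_mono {m n n' : ℝ} (hm : 0 < m) (hn : 1 ≤ n) (hnn' : n ≤ n') : psi m n ≤ psi m n' := by
  unfold psi
  have : 1 / n' ≤ 1 / n := one_div_le_one_div_of_le (by linarith) hnn'
  gcongr

theorem one_div_le_psi {m n : ℝ} (hm : 0 < m) (hn : 1 ≤ n) : 1 / m ≤ psi m n := by
  unfold psi
  have h1 : 1 / n ≤ 1 := by rw [div_le_one (by linarith)]; exact hn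
  have h2 : 1 / m ≤ (2 - 1 / n) / m := by gcongr; linarith
  have h3 : 0 ≤ 8 * n / m ^ 2 := by positivity
  linarith

theorem psi_le {m n : ℝ} (hm : 0 < m) (hn : 1 ≤ n) (hnm : n ≤ m) : psi m n ≤ 10 / m := by
  unfold psi
  have h1 : (2 - 1 / n) / m ≤ 2 / m := by
    have : 0 ≤ 1 / n := by positivity
    gcongr; linarith
  have h2 : 8 * n / m ^ 2 ≤ 8 / m := by
    rw [div_le_div_iff₀ (by positivity) hm]
    nlinarith
  have h3 : 10 / m = 2 / m + 8 / m := by ring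
  linarith

/-- Here w is the weight of splitting. The part -1/(n m) of `psi` grows by 1/(n(n-1)m) from n - 1 to
n, against a loss of at most 2/(n(n-1)(n+1)m) from splitting. The part 8n/m² grows by 8/m² and
absorbs the second-order terms, including the quadratic error. -/
theorem psi_step {m n w : ℝ} (hm : 40 ≤ m) (hn : 2 ≤ n) (hw : w ≤ 1 / n) :
    psi m (n - 1) + w * (psi (m - 1) (n + 1) - psi m (n - 1)) + 1 / m ^ 2 ≤ psi m n := by
  have hm0 : 0 < m := by linarith
  have hm1 : 0 < m - 1 := by linarith
  have hn1 : 0 < n - 1 := by linarith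
  have e1 : psi m n - psi m (n - 1) = 1 / (n * (n - 1) * m) + 8 / m ^ 2 := by
    unfold psi; field_simp; ring
  have e2 : psi (m - 1) (n + 1) - psi m (n - 1) = 2 / ((n - 1) * (n + 1) * m)
      + (2 - 1 / (n + 1)) / (m * (m - 1))
      + 8 * (2 / m ^ 2 + (n + 1) * ((2 * m - 1) / (m - 1) ^ 2) / m ^ 2) := by
    unfold psi; field_simp; ring
  have b1 : (2 - 1 / (n + 1)) / (m * (m - 1)) ≤ 21 / 10 / m ^ 2 := by
    have h0 : 0 ≤ 1 / (n + 1) := by positivity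
    rw [div_le_div_iff₀ (by positivity) (by positivity)]
    have : (2 - 1 / (n + 1)) * m ^ 2 ≤ 2 * m ^ 2 := by gcongr; linarith
    nlinarith
  have b2 : (2 * m - 1) / (m - 1) ^ 2 ≤ 1 / 16 := by
    rw [div_le_div_iff₀ (by positivity) (by norm_num)]
    nlinarith
  have b3 : psi (m - 1) (n + 1) - psi m (n - 1) ≤ 2 / ((n - 1) * (n + 1) * m)
      + (181 / 10 + (n + 1) / 2) / m ^ 2 := by
    rw [e2]
    have : (n + 1) * ((2 * m - 1) / (m - 1) ^ 2) / m ^ 2 ≤ (n + 1) * (1 / 16) / m ^ 2 := by gcongr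
    have e : 2 / ((n - 1) * (n + 1) * m) + (181 / 10 + (n + 1) / 2) / m ^ 2 =
      2 / ((n - 1) * (n + 1) * m) + 21 / 10 / m ^ 2
        + 8 * (2 / m ^ 2 + (n + 1) * (1 / 16) / m ^ 2) := by ring
    rw [e]
    linarith
  have hD : 0 ≤ psi (m - 1) (n + 1) - psi m (n - 1) := by
    rw [e2]
    have h1 : 1 / (n + 1) ≤ 1 := by rw [div_le_one (by linarith)]; linarith
    have h2 : 0 ≤ (2 - 1 / (n + 1)) / (m * (m - 1)) := by
      apply div_nonneg _ (by positivity); linarith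
    have h3 : 0 ≤ (2 * m - 1) / (m - 1) ^ 2 := by
      apply div_nonneg _ (by positivity); linarith
    positivity
  have b4 : w * (psi (m - 1) (n + 1) - psi m (n - 1)) ≤
      1 / n * (2 / ((n - 1) * (n + 1) * m) + (181 / 10 + (n + 1) / 2) / m ^ 2) :=
    (mul_le_mul_of_nonneg_right hw hD).trans (mul_le_mul_of_nonneg_left b3 (by positivity))
  have b5 : 1 / n * (2 / ((n - 1) * (n + 1) * m) + (181 / 10 + (n + 1) / 2) / m ^ 2) + 1 / m ^ 2 ≤
      1 / (n * (n - 1) * m) + 8 / m ^ 2 := by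
    have e3 : 1 / (n * (n - 1) * m) + 8 / m ^ 2
        - (1 / n * (2 / ((n - 1) * (n + 1) * m) + (181 / 10 + (n + 1) / 2) / m ^ 2) + 1 / m ^ 2)
        = (m / (n + 1) + 13 / 2 * n - 186 / 10) / (n * m ^ 2) := by
      field_simp; ring
    -- For n ≤ 3 the term m/(n + 1) ≥ 10 is needed, which is where m ≥ 40 enters; for n ≥ 3 the term
    -- 13n/2 suffices.
    have : 0 ≤ (m / (n + 1) + 13 / 2 * n - 186 / 10) / (n * m ^ 2) := by
      apply div_nonneg _ (by positivity)
      rcases le_total n 3 with h3 | h3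
      · have : 10 ≤ m / (n + 1) := by rw [le_div_iff₀ (by linarith)]; linarith
        linarith
      · have : 0 ≤ m / (n + 1) := by positivity
        linarith
    linarith
  linarith

/-! ### The main induction and the theorem -/

/-- The number of positive entries. -/
def posCount (l : List ℕ) : ℕ := l.countP (0 < ·)

theorem posCount_perm {l l' : List ℕ} (h : l.Perm l') : posCount l = posCount l' := h.countP_eq _

theorem posCount_pos {l : List ℕ} (h : 1 ≤ l.sum) : 1 ≤ posCount l := by
  by_contra hc
  have h0 : posCount l = 0 := by omega
  rw [posCount, List.countP_eq_zero] at h0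
  have : l.sum = 0 := List.sum_eq_zero fun x hx => by simpa using h0 x hx
  omega

theorem posCount_le_sum (l : List ℕ) : posCount l ≤ l.sum := by
  induction l with
  | nil => simp [posCount]
  | cons s l ih =>
    rw [posCount, List.countP_cons, List.sum_cons]
    unfold posCount at ih
    split_ifs with h
    · simp at h; omega
    · omega

theorem inv_pi_le_one : 1 / Real.pi ≤ 1 := by
  rw [div_le_one Real.pi_pos]
  linarith [Real.pi_gt_three]

theorem abs_sub_le_of_pos {l : List ℕ}
    (W : ℕ) (ih : ∀ t : List ℕ, weight t < W → 1 ≤ t.sum →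
      |nc t - 1 / Real.pi| ≤ 1000 * psi t.sum (posCount t))
    (hW : weight l = W) (h0 : 0 ∉ l) (hlen : 2 ≤ l.length) (hm : 40 ≤ l.sum) :
    |nc l - 1 / Real.pi| ≤ 1000 * psi l.sum l.length := by
  have hl : l ≠ [] := by rintro rfl; simp at hlen
  obtain ⟨d, t, hp, hmin⟩ := exists_perm_min_cons l hl
  have hpos : ∀ s ∈ d :: t, 1 ≤ s := by
    intro s hs
    have : s ≠ 0 := fun h => h0 (hp.mem_iff.2 (h ▸ hs))
    omega
  have hd : 1 ≤ d := hpos d (by simp)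
  have ht : ∀ s ∈ t, 1 ≤ s := fun s hs => hpos s (by simp [hs])
  have hW' : weight (d :: t) = W := by rw [← weight_perm hp, hW]
  have hwc := weight_cons d t
  have hsum : l.sum = d + t.sum := by rw [hp.sum_eq, List.sum_cons]
  have hlen' : l.length = t.length + 1 := by rw [hp.length_eq, List.length_cons]
  set m : ℝ := (l.sum : ℝ) with hmdef
  set n : ℝ := (l.length : ℝ) with hndef
  have hmd : m = d + t.sum := by rw [hmdef, hsum, Nat.cast_add]
  have hnt : n = t.length + 1 := by rw [hndef, hlen', Nat.cast_add, Nat.cast_one]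
  have hm40 : (40 : ℝ) ≤ m := by rw [hmdef]; exact_mod_cast hm
  have hn2 : (2 : ℝ) ≤ n := by rw [hndef]; exact_mod_cast hlen
  have hnm : n ≤ m := by
    have h1 := List.length_le_sum_of_one_le (d :: t) hpos
    have : l.length ≤ l.sum := by rw [hp.length_eq, hp.sum_eq]; exact h1
    rw [hmdef, hndef]
    exact_mod_cast this
  have step : ∀ (s : List ℕ) (k : ℝ), weight s < W → 1 ≤ s.sum → (posCount s : ℝ) ≤ k →
      |nc s - 1 / Real.pi| ≤ 1000 * psi s.sum k := by
    intro s k hw hs hk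
    refine (ih s hw hs).trans (mul_le_mul_of_nonneg_left (psi_mono ?_ ?_ hk) (by norm_num))
    · exact_mod_cast hs
    · exact_mod_cast posCount_pos hs
  have hlin : ∀ s, s ≠ [] → weight s < weight (d :: t) → nc s ≤ ((s.sum : ℝ) + 1) / 4 :=
    fun s hs _ => nc_le_linear s hs
  have hpred : ((((d - 1) :: t).sum : ℕ) : ℝ) = m - 1 := by
    rw [List.sum_cons, Nat.cast_add, Nat.cast_sub hd, hmd, Nat.cast_one]; ring
  -- For m ≥ 40 the inductive bound is at most 1000, and 1/π ≤ 1.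
  have hM : nc ((d - 1) :: t) ≤ 1001 := by
    have h1 := step ((d - 1) :: t) n (by rw [weight_cons]; omega) (by
      rw [List.sum_cons]; omega) (by
      rw [hndef, hlen']; exact_mod_cast List.countP_le_length)
    rw [hpred] at h1
    have h2 : psi (m - 1) n ≤ 1 := by
      unfold psi
      have h3 : (2 - 1 / n) / (m - 1) ≤ 2 / 39 := by
        have : 0 ≤ 1 / n := by positivity
        apply div_le_div₀ (by norm_num) (by linarith) (by norm_num) (by linarith)
      have h4 : 8 * n / (m - 1) ^ 2 ≤ 1 / 2 := by
        rw [div_le_div_iff₀ (by nlinarith) (by norm_num)]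
        nlinarith
      linarith
    have h5 := (abs_le.1 h1).2
    linarith [inv_pi_le_one]
  have hq := quadTerm_le d t hd ht _ hM hlin hmin
  have havg := abs_nc_cons_sub_le d t (by omega) (1 / Real.pi) (1000 * psi m (n - 1))
    (1000 * psi (m - 1) (n + 1))
    (fun i => by
      have h1 := step (t.set i (t.get i + d)) (n - 1) (by rw [weight_set]; omega)
        (by rw [sum_set]; omega) (by
          have : posCount (t.set i (t.get i + d)) ≤ t.length := by
            have := List.countP_le_length (p := (0 < · : ℕ → Bool)) (l := t.set i (t.get i + d))
            rwa [List.length_set] at this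
          rw [hnt, add_sub_cancel_right]
          exact_mod_cast this)
      rwa [sum_set, show t.sum + d = l.sum by omega] at h1)
    (fun a ha => by
      have e : (a :: (d - 1 - a) :: t).sum + 1 = l.sum := by
        simp only [List.sum_cons]; omega
      have h1 := step (a :: (d - 1 - a) :: t) (n + 1)
        (by simp only [weight_cons]; omega) (by omega) (by
          have : posCount (a :: (d - 1 - a) :: t) ≤ l.length + 1 := by
            rw [hlen']; exact List.countP_le_length
          rw [hndef]
          exact_mod_cast this)
      have e' : (((a :: (d - 1 - a) :: t).sum : ℕ) : ℝ) = m - 1 := by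
        rw [hmdef, ← e, Nat.cast_add, Nat.cast_one, add_sub_cancel_right]
      rwa [e'] at h1)
  rw [nc_perm hp]
  have hX : (weight (d :: t) : ℝ) = 2 * m + n := by
    rw [← weight_perm hp, weight_eq, Nat.cast_add, Nat.cast_mul, Nat.cast_ofNat]
  have hwt : (weight t : ℝ) = 2 * m + n - 1 - 2 * d := by
    rw [← hX, weight_cons]; push_cast; ring
  rw [hX] at havg hq
  rw [hwt] at havg
  have hX1 : 0 < 2 * m + n - 1 := by linarith
  have hdR : (1 : ℝ) ≤ d := by exact_mod_cast hd
  have hw : 2 * (d : ℝ) / (2 * m + n - 1) ≤ 1 / n := by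
    have hminR : (d : ℝ) * n ≤ m := by
      rw [hnt, hmd]; exact_mod_cast hmin
    rw [div_le_div_iff₀ hX1 (by linarith)]
    linarith
  have hpsi := psi_step hm40 hn2 hw
  -- Both X - 1 and X - 2 are at least 2m, so the quadratic term divided by X - 1 is O(1/m²), within
  -- the allowance of `psi_step`.
  have hquad : quadTerm d t ≤ (2 * m + n - 1) * (1000 / m ^ 2) := by
    refine hq.trans ?_
    rw [div_le_iff₀ (by linarith)]
    have : (1000 : ℝ) ≤ (2 * m + n - 1) * (1000 / m ^ 2) * (2 * m + n - 2) := by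
      rw [mul_assoc, div_mul_eq_mul_div, ← mul_div_assoc, le_div_iff₀ (by positivity)]
      nlinarith
    linarith
  refine le_of_mul_le_mul_left ?_ hX1
  refine havg.trans ?_
  have h1 : (2 * m + n - 1) * (1000 * (psi m (n - 1)
      + 2 * (d : ℝ) / (2 * m + n - 1) * (psi (m - 1) (n + 1) - psi m (n - 1)) + 1 / m ^ 2)) ≤
      (2 * m + n - 1) * (1000 * psi m n) := by gcongr
  refine le_trans ?_ h1
  have h2 : (2 * m + n - 1) * (1000 * (psi m (n - 1)
      + 2 * (d : ℝ) / (2 * m + n - 1) * (psi (m - 1) (n + 1) - psi m (n - 1)) + 1 / m ^ 2)) =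
      (2 * m + n - 1) * (1000 * psi m (n - 1))
      + 2 * (d : ℝ) * (1000 * (psi (m - 1) (n + 1) - psi m (n - 1)))
      + (2 * m + n - 1) * (1000 / m ^ 2) := by
    field_simp
  rw [h2]
  linarith

theorem abs_nc_sub_le_psi (l : List ℕ) (hl : 1 ≤ l.sum) :
    |nc l - 1 / Real.pi| ≤ 1000 * psi l.sum (posCount l) := by
  have key : ∀ W, ∀ l : List ℕ, weight l = W → 1 ≤ l.sum →
      |nc l - 1 / Real.pi| ≤ 1000 * psi l.sum (posCount l) := by
    intro W
    induction W using Nat.strong_induction_on with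
    | _ W ih =>
      intro l hW hl
      have hm1 : (1 : ℝ) ≤ l.sum := by exact_mod_cast hl
      have hp1 : (1 : ℝ) ≤ posCount l := by exact_mod_cast posCount_pos hl
      have hpsi := one_div_le_psi (by linarith : (0 : ℝ) < l.sum) hp1
      by_cases h0 : 0 ∈ l
      · have hp := List.perm_cons_erase h0
        have hs : l.sum = (l.erase 0).sum := by rw [hp.sum_eq, List.sum_cons, zero_add]
        have he : l.erase 0 ≠ [] := by
          intro he
          rw [he] at hs
          simp at hs
          omega
        have hc : posCount l = posCount (l.erase 0) := by
          rw [posCount_perm hp, posCount, List.countP_cons]; simp [posCount]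
        rw [nc_perm hp, nc_zero_cons _ he, hs, hc]
        refine ih _ ?_ _ rfl (by omega)
        rw [← hW, weight_perm hp, weight_cons]
        omega
      have hlen : posCount l = l.length := by
        rw [posCount, List.countP_eq_length]
        intro a ha
        have : a ≠ 0 := fun h => h0 (h ▸ ha)
        simp; omega
      have hne : l ≠ [] := by rintro rfl; simp at hl
      -- For small sums the linear bound gives at most 41/4, below 1000/40.
      by_cases hm : l.sum < 40
      · have h1 := nc_le_linear l hne
        have h2 := nc_nonneg l
        have hmR : (l.sum : ℝ) ≤ 40 := by exact_mod_cast hm.le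
        have h3 : 1 / 40 ≤ 1 / (l.sum : ℝ) := one_div_le_one_div_of_le (by linarith) hmR
        have h4 : 0 ≤ 1 / Real.pi := by positivity
        have h5 := inv_pi_le_one
        rw [abs_le]
        constructor <;> linarith
      by_cases hl2 : 2 ≤ l.length
      · rw [hlen]
        exact abs_sub_le_of_pos W (fun t ht hs => ih _ ht t rfl hs) hW h0 hl2 (by omega)
      · have hl1 : l.length = 1 := by
          have := List.length_pos_iff.2 hne
          omega
        obtain ⟨k, rfl⟩ := List.length_eq_one_iff.1 hl1
        refine (abs_nc_singleton_sub k).trans ?_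
        rw [List.sum_singleton] at hm1 hpsi ⊢
        have : 1 / ((k : ℝ) + 1) ≤ 1 / (k : ℝ) := one_div_le_one_div_of_le (by linarith) (by linarith)
        have h4 : 0 ≤ 1 / (k : ℝ) := by positivity
        linarith
  exact key _ l rfl hl

theorem nc_eq_of_sum_eq_zero (l : List ℕ) (hl : l ≠ []) (h : l.sum = 0) : nc l = 1 / 4 := by
  induction l with
  | nil => exact absurd rfl hl
  | cons s l ih =>
    rw [List.sum_cons] at h
    obtain rfl : s = 0 := by omega
    by_cases hl' : l = []
    · rw [hl', nc_singleton_zero]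
    · rw [nc_zero_cons l hl', ih hl' (by omega)]

theorem C_eq_nc {n : ℕ} (d : Fin n → ℕ) : (C d : ℝ) = nc (List.ofFn d) := by
  have hX : X d = weight (List.ofFn d) := by
    rw [X, weight, List.map_ofFn, List.sum_ofFn]
    rfl
  have hg : 2 * genus d - 1 = 2 * (List.ofFn d).sum + 1 := by
    rw [genus, List.sum_ofFn]; omega
  have hprod : (∏ j, (((2 * d j + 1).doubleFactorial : ℕ) : ℚ)) ≠ 0 :=
    Finset.prod_ne_zero_iff.2 fun j _ => by
      exact_mod_cast (Nat.doubleFactorial_pos _).ne'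
  have h : C d = 2 ^ (2 * (List.ofFn d).sum + 1) * B (List.ofFn d)
      / ((weight (List.ofFn d) - 1).factorial : ℚ) := by
    rw [C, bgwNumber, hX, hg]
    field_simp
  rw [h, nc]
  push_cast
  rfl

end BGW

theorem theorem1p1 :
    ∃ K : ℝ, ∀ (n : ℕ), 1 ≤ n → ∀ d : Fin n → ℕ,
      |(BGW.C d : ℝ) - 1 / Real.pi| ≤ K / (BGW.genus d : ℝ) := by
  -- For m ≥ 1 the bound is 1000 · 10/m, and 1/m ≤ 2/(m + 1) = 2/g.
  refine ⟨20000, fun n hn d => ?_⟩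
  rw [BGW.C_eq_nc]
  have hne : List.ofFn d ≠ [] := by
    rw [← List.length_pos_iff, List.length_ofFn]; omega
  have hg : (BGW.genus d : ℝ) = ((List.ofFn d).sum : ℝ) + 1 := by
    rw [BGW.genus, List.sum_ofFn, Nat.cast_add, Nat.cast_one]
  rw [hg]
  rcases Nat.eq_zero_or_pos (List.ofFn d).sum with h0 | h1
  · rw [BGW.nc_eq_of_sum_eq_zero _ hne h0, h0]
    have h4 : 0 ≤ 1 / Real.pi := by positivity
    have h5 := BGW.inv_pi_le_one
    rw [Nat.cast_zero, zero_add, div_one, abs_le]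
    constructor <;> linarith
  · have hm : (1 : ℝ) ≤ (List.ofFn d).sum := by exact_mod_cast h1
    refine (BGW.abs_nc_sub_le_psi _ h1).trans ?_
    have h2 := BGW.psi_le (m := ((List.ofFn d).sum : ℝ)) (n := (BGW.posCount (List.ofFn d) : ℝ))
      (by linarith) (by exact_mod_cast BGW.posCount_pos h1)
      (by exact_mod_cast BGW.posCount_le_sum _)
    refine (mul_le_mul_of_nonneg_left h2 (by norm_num)).trans ?_
    rw [← mul_div_assoc, div_le_div_iff₀ (by linarith) (by linarith)]
    linarith
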